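/- **Conventions.** A *presentation* $\mathbf A^\#$ of a unital $\mathrm C^*$-algebra $\mathbf A$ is a sequence of *special points* of $\mathbf A$ that generates a dense $*$-subalgebra; its *rational points* are the values at the special points of the $*$-polynomials over $\mathbb Q(i)$ without constant term. It is *c.e.* (right-c.e.) if an algorithm, given a rational point $q$, enumerates a decreasing sequence of rationals converging to $\|q\|$; (a code of) such an algorithm is an *index* of $\mathbf A^\#$. A $*$-homomorphism $\psi:\mathbf A_0\to\mathbf A_1$ (not necessarily unital) is *computable* from $\mathbf A_0^\#$ to $\mathbf A_1^\#$ if an algorithm, given a rational point $a$ of $\mathbf A_0^\#$ and $k\in\mathbb N$, computes a rational point $b$ of $\mathbf A_1^\#$ with $\|\psi(a)-b\|<2^{-k}$. A *presentation* of a semigroup (group) $S$ is an epimorphism $\nu$ onto $S$ from the free semigroup (free group) on countably many generators; a word $w$ is a *label* of $\nu(w)$; the presentation is *c.e.* (recursive) if $\{(w,w'):\nu(w)=\nu(w')\}$ is c.e., an index of it being an index of this c.e. set. A map between presented (semi)groups is computable if some algorithm turns each label of each $x$ into a label of the image of $x$; a subset is c.e. if the set of labels of its elements is c.e. In each case an index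 of a morphism is an index of the algorithm. Let $\mathcal D(\mathbf A)$ be the abelian semigroup, under $\oplus$, of Murray–von Neumann classes of projections in matrix algebras over $\mathbf A$, with $\mathcal D(\psi)[p]=[\psi_n(p)]$ for $p\in M_n(\mathbf A)$; let $\mathcal G$ be the Grothendieck functor from abelian semigroups to abelian groups, with canonical maps $\gamma_S:S\to\mathcal G(S)$; let $K_0(\mathbf A)=\mathcal G(\mathcal D(\mathbf A))$ and $K_0(\mathbf A)^+=\{\gamma_{\mathcal D(\mathbf A)}([p])\}$, where $p$ runs over all projections in matrix algebras over $\mathbf A$. The categories of c.e. presentations have the c.e. presentations as objects and the computable homomorphisms as morphisms. An object of the category of c.e. presentations of unital $\mathrm C^*$-algebras is given together with an index of its presentation. (So the image of an object may depend on its index, but only up to a computable isomorphism over the identity, since the identity of $\mathbf A$ is a morphism between objects that differ only in the index.) A functor between such categories is *computable* if there are an algorithm that turns every index of an object into an index of its image and an algorithm that turns every index of a morphism, together with indices of its source and target, into an index of its image. **Theorem.** 1. There is a computable functor from the category of c.e. presentations of unital $\mathrm C^*$-algebras to the category of c.e. presentations of abelian semigroups that sends each $\mathbf A^\#$ to a c.e.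 presentation $\mathcal D(\mathbf A^\#)$ of $\mathcal D(\mathbf A)$ and each $\psi$ to $\mathcal D(\psi)$. Moreover, $\mathbf A^\#$ computably supports $\mathcal D(\mathbf A^\#)$, uniformly: there is an algorithm that, given the index of $\mathbf A^\#$ and a word $w$, computes $n$ and the code of an algorithm which, given $k$, computes a rational point within $2^{-k}$ of $p$, where $p$ is a projection in $M_n(\mathbf A)$ such that $w$ is a label of $[p]$ (here $M_n(\mathbf A)$ is presented by the matrices with a single nonzero entry, a special point of $\mathbf A^\#$). 2. There is a computable functor from the category of c.e. presentations of abelian semigroups to the category of c.e. presentations of abelian groups that sends each $S^\#$ to a c.e. presentation $\mathcal G(S^\#)$ of $\mathcal G(S)$ and each $\varphi$ to $\mathcal G(\varphi)$. Moreover, $\gamma_S$ is computable from $S^\#$ to $\mathcal G(S^\#)$, uniformly in an index of $S^\#$. 3. The composition $K_0$ of these two functors is a computable functor from the category of c.e. presentations of unital $\mathrm C^*$-algebras to the category of c.e. presentations of abelian groups; it sends each $\mathbf A^\#$ to a c.e. presentation $K_0(\mathbf A^\#)$ of the abelian group $K_0(\mathbf A)$. If $\mathbf A$ is stably finite, then $K_0(\mathbf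 A)^+$ is a c.e. subset of $K_0(\mathbf A^\#)$. -/

import Mathlib

open Filter Topology CategoryTheory Matrix
open Nat.Partrec (Code)

universe u

namespace EffectiveK

noncomputable section

/-! ### Algorithms and their indices -/

/-- On input `a`, the algorithm with index `c` halts with output `b`. -/
def Outputs {α β : Type} [Primcodable α] [Primcodable β] (c : Code) (a : α) (b : β) : Prop :=
  Encodable.encode b ∈ c.eval (Encodable.encode a)

/-- The c.e. set with index `c`: the set of inputs on which the algorithm `c` halts. -/
def ceSet {α : Type} [Primcodable α] (c : Code) : Set α :=
  {a | (c.eval (Encodable.encode a)).Dom}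

/-- Codes of rational numbers: `(a, b, d)` is a code of `(a - b) / (d + 1)`. -/
abbrev RatCode : Type := ℕ × ℕ × ℕ

def RatCode.val (t : RatCode) : ℚ := ((t.1 : ℚ) - t.2.1) / (t.2.2 + 1)

/-! ### Noncommutative rational `*`-polynomials without constant term -/

/-- `(i, false)` is the variable `x_i`, and `(i, true)` is `x_i^*`. -/
abbrev Letter : Type := ℕ × Bool

/-- A noncommutative `*`-polynomial over `ℚ(i)` with no constant term, as the list of its terms
`(re, im), l, w`: the coefficient `re + i * im` times the nonempty word `l w`. -/
abbrev StarPoly : Type := List ((RatCode × RatCode) × Letter × List Letter)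

section Eval

variable {R : Type u} [NonUnitalRing R] [Star R] [Module ℂ R]

def evalLetter (a : ℕ → R) (l : Letter) : R := if l.2 then star (a l.1) else a l.1

def evalWord (a : ℕ → R) (l : Letter) (w : List Letter) : R :=
  w.foldl (fun x m => x * evalLetter a m) (evalLetter a l)

/-- The value of a `*`-polynomial at the sequence `a`; these values are the rational points of the
presentation with special points `a`. -/
def StarPoly.eval (p : StarPoly) (a : ℕ → R) : R :=
  (p.map fun t =>
    ((⟨(t.1.1.val : ℝ), (t.1.2.val : ℝ)⟩ : ℂ)) • evalWord a t.2.1 t.2.2).sum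

end Eval

/-! ### Presentations of C*-algebras -/

/-- A presentation of a C*-algebra: a sequence of special points that generates it. -/
structure CStarPresentation (A : Type u) [CStarAlgebra A] where
  point : ℕ → A
  dense_adjoin : Dense (NonUnitalStarAlgebra.adjoin ℂ (Set.range point) : Set A)

/-- `c` is a right-c.e. index of the presentation: given a rational point, it enumerates a decreasing
sequence of rational numbers that converges to the norm of that point. -/
def CStarPresentation.IsRightCEIndex {A : Type u} [CStarAlgebra A] (P : CStarPresentation A)
    (c : Code) : Prop :=
  ∀ p : StarPoly, ∃ r : ℕ → RatCode, (∀ n, Outputs c (p, n) (r n)) ∧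
    Antitone (fun n => (r n).val) ∧
    Tendsto (fun n => ((r n).val : ℝ)) atTop (𝓝 ‖p.eval P.point‖)

/-- `c` is an index of `φ` as a computable map from `P` to `Q`. -/
def IsStarHomIndex {A B : Type u} [CStarAlgebra A] [CStarAlgebra B]
    (P : CStarPresentation A) (Q : CStarPresentation B) (φ : A →⋆ₙₐ[ℂ] B) (c : Code) : Prop :=
  ∀ (p : StarPoly) (k : ℕ), ∃ q : StarPoly, Outputs c (p, k) q ∧
    ‖φ (p.eval P.point) - q.eval Q.point‖ < (2 : ℝ)⁻¹ ^ k

/-- A unital C*-algebra with a c.e. (that is, right-c.e.) presentation, given by an index. The index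
is part of the object: the presentation of the Murray-von Neumann semigroup may depend on it. Different
indices of one presentation give isomorphic objects, by the identity morphisms. -/
structure CStarCE : Type (u + 1) where
  carrier : Type u
  [str : CStarAlgebra carrier]
  pres : CStarPresentation carrier
  index : Code
  isIndex : pres.IsRightCEIndex index

attribute [instance] CStarCE.str

theorem isStarHomIndex_id {A : Type u} [CStarAlgebra A] (P : CStarPresentation A) :
    IsStarHomIndex P P (NonUnitalStarAlgHom.id ℂ A) Code.left := by
  intro p k
  refine ⟨p, ?_, ?_⟩
  · simp [Outputs, Code.eval, Encodable.encode_prod_val]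
  · simp

theorem mem_eval_comp {c d : Code} {x y z : ℕ} (h : y ∈ c.eval x) (h' : z ∈ d.eval y) :
    z ∈ (Code.comp d c).eval x :=
  Part.mem_bind h h'

theorem mem_eval_pair {c d : Code} {x y z : ℕ} (h : y ∈ c.eval x) (h' : z ∈ d.eval x) :
    Nat.pair y z ∈ (Code.pair c d).eval x :=
  Part.mem_bind (Part.mem_map Nat.pair h) (Part.mem_map (Nat.pair y) h')

theorem exists_isStarHomIndex_comp {A B C : Type u} [CStarAlgebra A] [CStarAlgebra B]
    [CStarAlgebra C] {P : CStarPresentation A} {Q : CStarPresentation B}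
    {R : CStarPresentation C} {φ : A →⋆ₙₐ[ℂ] B} {ψ : B →⋆ₙₐ[ℂ] C} {c d : Code}
    (hc : IsStarHomIndex P Q φ c) (hd : IsStarHomIndex Q R ψ d) :
    ∃ e, IsStarHomIndex P R (ψ.comp φ) e := by
  refine ⟨Code.comp d (Code.pair (Code.comp c (Code.pair Code.left (Code.comp Code.succ Code.right)))
    (Code.comp Code.succ Code.right)), fun p k => ?_⟩
  obtain ⟨q, hq, hq'⟩ := hc p (k + 1)
  obtain ⟨r, hr, hr'⟩ := hd q (k + 1)
  refine ⟨r, ?_, ?_⟩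
  · simp only [Outputs, Encodable.encode_prod_val, Encodable.encode_nat] at hq hr ⊢
    have hk : k + 1 ∈ (Code.comp Code.succ Code.right).eval (Nat.pair (Encodable.encode p) k) :=
      mem_eval_comp (y := k) (by simp [Code.eval]) (by simp [Code.eval])
    have hp : Encodable.encode p ∈ Code.left.eval (Nat.pair (Encodable.encode p) k) := by
      simp [Code.eval]
    exact mem_eval_comp (mem_eval_pair (mem_eval_comp (mem_eval_pair hp hk) hq) hk) hr
  · have h1 : ‖ψ (φ (p.eval P.point)) - ψ (q.eval Q.point)‖ ≤
        ‖φ (p.eval P.point) - q.eval Q.point‖ := by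
      rw [← map_sub]
      exact NonUnitalStarAlgHom.norm_apply_le ψ _
    have h2 := norm_sub_le_norm_sub_add_norm_sub (ψ (φ (p.eval P.point))) (ψ (q.eval Q.point))
      (r.eval R.point)
    have h3 : (2 : ℝ)⁻¹ ^ k = (2 : ℝ)⁻¹ ^ (k + 1) + (2 : ℝ)⁻¹ ^ (k + 1) := by
      rw [pow_succ]; ring
    rw [h3]
    simp only [NonUnitalStarAlgHom.comp_apply]
    linarith

/-- The category of c.e. presentations of unital C*-algebras, with the computable
`*`-homomorphisms (not required to preserve the units) as morphisms. -/
instance : Category CStarCE.{u} where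
  Hom X Y := {φ : X.carrier →⋆ₙₐ[ℂ] Y.carrier // ∃ c, IsStarHomIndex X.pres Y.pres φ c}
  id X := ⟨NonUnitalStarAlgHom.id ℂ X.carrier, _, isStarHomIndex_id X.pres⟩
  comp f g := ⟨g.1.comp f.1,
    Exists.elim f.2 fun _ hc => Exists.elim g.2 fun _ hd => exists_isStarHomIndex_comp hc hd⟩

/-! ### Presentations of semigroups and groups

The kernel, computable maps and c.e. subsets are expressed through a labelling `W → S` of the elements
of `S` by (codes of) words. -/

/-- `c` is an index of the c.e. set `{(w, w') | w and w' label the same element}`. -/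
def IsKernelIndex {W : Type} [Primcodable W] {S : Type u} (label : W → S) (c : Code) : Prop :=
  (ceSet c : Set (W × W)) = {w | label w.1 = label w.2}

/-- `c` is an index of `f` as a computable map: it turns each label of each `x` into a label
of `f x`. -/
def IsMapIndex {W V : Type} [Primcodable W] [Primcodable V] {S T : Type u}
    (label : W → S) (label' : V → T) (f : S → T) (c : Code) : Prop :=
  ∀ w, ∃ v, Outputs c w v ∧ label' v = f (label w)

/-- `X` is a c.e. subset: the set of all labels of elements of `X` is c.e. -/
def IsCESubset {W : Type} [Primcodable W] {S : Type u} (label : W → S) (X : Set S) : Prop :=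
  REPred fun w => label w ∈ X

theorem isMapIndex_id {W : Type} [Primcodable W] {S : Type u} (l : W → S) :
    IsMapIndex l l id Code.id :=
  fun w => ⟨w, by simp [Outputs], rfl⟩

theorem isMapIndex_comp {W V U : Type} [Primcodable W] [Primcodable V] [Primcodable U]
    {S T R : Type u} {l : W → S} {l' : V → T} {l'' : U → R} {f : S → T} {g : T → R} {c d : Code}
    (hc : IsMapIndex l l' f c) (hd : IsMapIndex l' l'' g d) :
    IsMapIndex l l'' (g ∘ f) (Code.comp d c) := by
  intro w
  obtain ⟨v, hv, hv'⟩ := hc w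
  obtain ⟨x, hx, hx'⟩ := hd v
  refine ⟨x, ?_, by simp [hx', hv']⟩
  simp only [Outputs] at hv hx ⊢
  exact mem_eval_comp hv hx

/-- A presentation of a semigroup `S` (written additively): an epimorphism onto `S` from the free
semigroup on countably many indeterminates. -/
structure SemigroupPresentation (S : Type u) [AddSemigroup S] where
  ν : FreeAddSemigroup ℕ →ₙ+ S
  surj : Function.Surjective ν

/-- A word `x_i x_{j_1} ... x_{j_r}` is coded as `(i, [j_1, ..., j_r])`. -/
def SemigroupPresentation.label {S : Type u} [AddSemigroup S] (P : SemigroupPresentation S)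
    (w : ℕ × List ℕ) : S := P.ν ⟨w.1, w.2⟩

def SemigroupPresentation.IsCE {S : Type u} [AddSemigroup S] (P : SemigroupPresentation S) : Prop :=
  ∃ c, IsKernelIndex P.label c

/-- A presentation of a group `G` (written additively): an epimorphism onto `G` from the free
group on countably many indeterminates. -/
structure GroupPresentation (G : Type u) [AddGroup G] where
  ν : FreeAddGroup ℕ →+ G
  surj : Function.Surjective ν

/-- Elements of the free group are coded by the (not necessarily reduced) words that represent
them. Since words can be reduced effectively, this gives the usual c.e. subsets of the free group. -/
def GroupPresentation.label {G : Type u} [AddGroup G] (P : GroupPresentation G)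
    (w : List (ℕ × Bool)) : G := P.ν (FreeAddGroup.mk w)

def GroupPresentation.IsCE {G : Type u} [AddGroup G] (P : GroupPresentation G) : Prop :=
  ∃ c, IsKernelIndex P.label c

/-- An abelian semigroup with a c.e. presentation. -/
structure AbSemigroupCE : Type (u + 1) where
  carrier : Type u
  [str : AddCommSemigroup carrier]
  pres : SemigroupPresentation carrier
  ce : pres.IsCE

/-- An abelian group with a c.e. presentation. -/
structure AbGroupCE : Type (u + 1) where
  carrier : Type u
  [str : AddCommGroup carrier]
  pres : GroupPresentation carrier
  ce : pres.IsCE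

attribute [instance] AbSemigroupCE.str AbGroupCE.str

instance (X : AbSemigroupCE.{u}) : Nonempty X.carrier := ⟨X.pres.label (0, [])⟩

/-- The category of c.e. presentations of abelian semigroups and computable homomorphisms. -/
instance : Category AbSemigroupCE.{u} where
  Hom X Y := {f : X.carrier →ₙ+ Y.carrier // ∃ c, IsMapIndex X.pres.label Y.pres.label f c}
  id X := ⟨AddHom.id X.carrier, _, isMapIndex_id _⟩
  comp f g := ⟨g.1.comp f.1,
    Exists.elim f.2 fun _ hc => Exists.elim g.2 fun _ hd =>
      ⟨_, isMapIndex_comp (f := f.1) (g := g.1) hc hd⟩⟩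

/-- The category of c.e. presentations of abelian groups and computable homomorphisms. -/
instance : Category AbGroupCE.{u} where
  Hom X Y := {f : X.carrier →+ Y.carrier // ∃ c, IsMapIndex X.pres.label Y.pres.label f c}
  id X := ⟨AddMonoidHom.id X.carrier, _, isMapIndex_id _⟩
  comp f g := ⟨g.1.comp f.1,
    Exists.elim f.2 fun _ hc => Exists.elim g.2 fun _ hd =>
      ⟨_, isMapIndex_comp (f := f.1) (g := g.1) hc hd⟩⟩

/-- The `*`-homomorphism that underlies a morphism. -/
def CStarCE.hom {X Y : CStarCE.{u}} (f : X ⟶ Y) : X.carrier →⋆ₙₐ[ℂ] Y.carrier := Subtype.val f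

/-- The semigroup homomorphism that underlies a morphism. -/
def AbSemigroupCE.hom {X Y : AbSemigroupCE.{u}} (f : X ⟶ Y) : X.carrier →ₙ+ Y.carrier :=
  Subtype.val f

/-- The group homomorphism that underlies a morphism. -/
def AbGroupCE.hom {X Y : AbGroupCE.{u}} (f : X ⟶ Y) : X.carrier →+ Y.carrier := Subtype.val f

/-! ### Computable functors -/

/-- A category whose objects and morphisms have indices. -/
class IndexedCategory (C : Type (u + 1)) extends Category.{u} C where
  ObjIndex : C → Code → Prop
  HomIndex : ∀ {X Y : C}, (X ⟶ Y) → Code → Prop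

instance : IndexedCategory CStarCE.{u} where
  ObjIndex X c := c = X.index
  HomIndex {X Y} f c := IsStarHomIndex X.pres Y.pres (CStarCE.hom f) c

instance : IndexedCategory AbSemigroupCE.{u} where
  ObjIndex X c := IsKernelIndex X.pres.label c
  HomIndex {X Y} f c := IsMapIndex X.pres.label Y.pres.label (AbSemigroupCE.hom f) c

instance : IndexedCategory AbGroupCE.{u} where
  ObjIndex X c := IsKernelIndex X.pres.label c
  HomIndex {X Y} f c := IsMapIndex X.pres.label Y.pres.label (AbGroupCE.hom f) c

/-- A functor is computable if an algorithm turns each index of an object into an index of its image,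
and an algorithm turns each index of a morphism (given with indices of its source and its target)
into an index of its image. -/
def IsComputableFunctor {C D : Type (u + 1)} [IndexedCategory C] [IndexedCategory D]
    (F : C ⥤ D) : Prop :=
  (∃ f : Code → Code, Computable f ∧
    ∀ X e, IndexedCategory.ObjIndex X e → IndexedCategory.ObjIndex (F.obj X) (f e)) ∧
  ∃ g : Code × Code × Code → Code, Computable g ∧
    ∀ (X Y : C) (φ : X ⟶ Y) (e e' c : Code), IndexedCategory.ObjIndex X e →
      IndexedCategory.ObjIndex Y e' → IndexedCategory.HomIndex φ c →
      IndexedCategory.HomIndex (F.map φ) (g (e, e', c))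

/-! ### The Murray-von Neumann semigroup -/

section MurrayVonNeumann

variable {A : Type u} [CStarAlgebra A]

/-- Murray-von Neumann equivalence of matrices, possibly of different sizes. -/
def MvNEquiv {m n : Type*} [Fintype m] [Fintype n] (p : Matrix m m A) (q : Matrix n n A) : Prop :=
  ∃ v : Matrix m n A, p = v * vᴴ ∧ q = vᴴ * v

variable {m n k l : Type*} [Fintype m] [Fintype n] [Fintype k] [Fintype l]

theorem MvNEquiv.refl {p : Matrix m m A} (hp : IsStarProjection p) : MvNEquiv p p := by
  have h1 : pᴴ = p := hp.isSelfAdjoint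
  have h2 : p * p = p := hp.isIdempotentElem
  exact ⟨p, by rw [h1, h2], by rw [h1, h2]⟩

theorem MvNEquiv.symm {p : Matrix m m A} {q : Matrix n n A} (h : MvNEquiv p q) :
    MvNEquiv q p := by
  obtain ⟨v, hp, hq⟩ := h
  exact ⟨vᴴ, by rw [conjTranspose_conjTranspose, hq], by rw [conjTranspose_conjTranspose, hp]⟩

theorem MvNEquiv.trans {p : Matrix m m A} {q : Matrix n n A} {r : Matrix k k A}
    (hp : IsStarProjection p) (hr : IsStarProjection r)
    (h : MvNEquiv p q) (h' : MvNEquiv q r) : MvNEquiv p r := by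
  obtain ⟨v, hpv, hqv⟩ := h
  obtain ⟨w, hqw, hrw⟩ := h'
  have h2 : p * p = p := hp.isIdempotentElem
  have h3 : r * r = r := hr.isIdempotentElem
  refine ⟨v * w, ?_, ?_⟩
  · calc p = v * (vᴴ * v) * vᴴ := by
          conv_lhs => rw [← h2, hpv]
          simp only [Matrix.mul_assoc]
      _ = v * w * (v * w)ᴴ := by
          rw [← hqv, hqw, conjTranspose_mul]
          simp only [Matrix.mul_assoc]
  · calc r = wᴴ * (w * wᴴ) * w := by
          conv_lhs => rw [← h3, hrw]
          simp only [Matrix.mul_assoc]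
      _ = (v * w)ᴴ * (v * w) := by
          rw [← hqw, hqv, conjTranspose_mul]
          simp only [Matrix.mul_assoc]

theorem MvNEquiv.fromBlocks {p : Matrix m m A} {p' : Matrix n n A} {q : Matrix k k A}
    {q' : Matrix l l A} (h : MvNEquiv p p') (h' : MvNEquiv q q') :
    MvNEquiv (Matrix.fromBlocks p 0 0 q) (Matrix.fromBlocks p' 0 0 q') := by
  obtain ⟨v, rfl, rfl⟩ := h
  obtain ⟨w, rfl, rfl⟩ := h'
  exact ⟨Matrix.fromBlocks v 0 0 w, by simp [fromBlocks_conjTranspose, fromBlocks_multiply],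
    by simp [fromBlocks_conjTranspose, fromBlocks_multiply]⟩

theorem isStarProjection_fromBlocks {p : Matrix m m A} {q : Matrix n n A}
    (hp : IsStarProjection p) (hq : IsStarProjection q) :
    IsStarProjection (Matrix.fromBlocks p 0 0 q) := by
  have h1 : pᴴ = p := hp.isSelfAdjoint
  have h2 : p * p = p := hp.isIdempotentElem
  have h3 : qᴴ = q := hq.isSelfAdjoint
  have h4 : q * q = q := hq.isIdempotentElem
  constructor
  · simp [IsIdempotentElem, fromBlocks_multiply, h2, h4]
  · change (Matrix.fromBlocks p 0 0 q)ᴴ = _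
    simp [fromBlocks_conjTranspose, h1, h3]

theorem isStarProjection_submatrix {p : Matrix m m A} (hp : IsStarProjection p) (e : n ≃ m) :
    IsStarProjection (p.submatrix e e) := by
  have h1 : pᴴ = p := hp.isSelfAdjoint
  have h2 : p * p = p := hp.isIdempotentElem
  constructor
  · simp [IsIdempotentElem, submatrix_mul_equiv, h2]
  · change (p.submatrix e e)ᴴ = _
    rw [conjTranspose_submatrix, h1]

theorem MvNEquiv.submatrix {p : Matrix m m A} (hp : IsStarProjection p) (e : n ≃ m) :
    MvNEquiv p (p.submatrix e e) := by
  have h1 : pᴴ = p := hp.isSelfAdjoint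
  have h2 : p * p = p := hp.isIdempotentElem
  refine ⟨p.submatrix id e, ?_, ?_⟩
  · rw [conjTranspose_submatrix, h1, submatrix_mul_equiv, h2, submatrix_id_id]
  · rw [conjTranspose_submatrix, h1]
    have := submatrix_mul p p e id e Function.bijective_id
    rw [← this, h2]

variable (A) in
/-- The projections in the matrix algebras over `A`. -/
abbrev Proj : Type u := Σ n : ℕ, {p : Matrix (Fin n) (Fin n) A // IsStarProjection p}

/-- The block-diagonal sum of two projections. -/
def Proj.sum (p q : Proj A) : Proj A :=
  ⟨p.1 + q.1, (Matrix.fromBlocks p.2.1 0 0 q.2.1).submatrix finSumFinEquiv.symm finSumFinEquiv.symm,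
    isStarProjection_submatrix (isStarProjection_fromBlocks p.2.2 q.2.2) _⟩

variable (A) in
def projSetoid : Setoid (Proj A) where
  r p q := MvNEquiv p.2.1 q.2.1
  iseqv :=
    { refl := fun p => MvNEquiv.refl p.2.2
      symm := fun h => h.symm
      trans := fun {p _ r} h h' => MvNEquiv.trans p.2.2 r.2.2 h h' }

variable (A) in
/-- The Murray-von Neumann semigroup of equivalence classes of projections in the matrix
algebras over `A`. -/
def MvN : Type u := Quotient (projSetoid A)

/-- The Murray-von Neumann class of a projection. -/
def MvN.mk (p : Proj A) : MvN A := Quotient.mk (projSetoid A) p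

theorem Proj.mvn_sum (p q : Proj A) :
    MvNEquiv (Matrix.fromBlocks p.2.1 0 0 q.2.1) (p.sum q).2.1 :=
  MvNEquiv.submatrix (isStarProjection_fromBlocks p.2.2 q.2.2) _

theorem Proj.sum_congr {p p' q q' : Proj A} (h : MvNEquiv p.2.1 p'.2.1)
    (h' : MvNEquiv q.2.1 q'.2.1) : MvNEquiv (p.sum q).2.1 (p'.sum q').2.1 := by
  have hq := isStarProjection_fromBlocks p'.2.2 q'.2.2
  exact MvNEquiv.trans (p.sum q).2.2 (p'.sum q').2.2
    (MvNEquiv.trans (p.sum q).2.2 hq (p.mvn_sum q).symm (h.fromBlocks h')) (p'.mvn_sum q')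

theorem Proj.sum_comm (p q : Proj A) : MvNEquiv (p.sum q).2.1 (q.sum p).2.1 := by
  have h1 := isStarProjection_fromBlocks p.2.2 q.2.2
  have h2 := isStarProjection_fromBlocks q.2.2 p.2.2
  have h3 := MvNEquiv.submatrix h1 (Equiv.sumComm (Fin q.1) (Fin p.1))
  rw [show (Matrix.fromBlocks p.2.1 0 0 q.2.1).submatrix (Equiv.sumComm (Fin q.1) (Fin p.1))
    (Equiv.sumComm (Fin q.1) (Fin p.1)) = Matrix.fromBlocks q.2.1 0 0 p.2.1 by
      ext (i | i) (j | j) <;> rfl] at h3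
  exact MvNEquiv.trans (p.sum q).2.2 (q.sum p).2.2
    (MvNEquiv.trans (p.sum q).2.2 h2 (p.mvn_sum q).symm h3) (q.mvn_sum p)

theorem Proj.sum_assoc (p q r : Proj A) :
    MvNEquiv ((p.sum q).sum r).2.1 (p.sum (q.sum r)).2.1 := by
  have h1 := isStarProjection_fromBlocks (isStarProjection_fromBlocks p.2.2 q.2.2) r.2.2
  have h2 := isStarProjection_fromBlocks p.2.2 (isStarProjection_fromBlocks q.2.2 r.2.2)
  have h3 := MvNEquiv.submatrix h1 (Equiv.sumAssoc (Fin p.1) (Fin q.1) (Fin r.1)).symm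
  rw [show (Matrix.fromBlocks (Matrix.fromBlocks p.2.1 0 0 q.2.1) 0 0 r.2.1).submatrix
      (Equiv.sumAssoc (Fin p.1) (Fin q.1) (Fin r.1)).symm
      (Equiv.sumAssoc (Fin p.1) (Fin q.1) (Fin r.1)).symm
      = Matrix.fromBlocks p.2.1 0 0 (Matrix.fromBlocks q.2.1 0 0 r.2.1) by
      ext (i | i | i) (j | j | j) <;> rfl] at h3
  have h4 : MvNEquiv (Matrix.fromBlocks (Matrix.fromBlocks p.2.1 0 0 q.2.1) 0 0 r.2.1)
      ((p.sum q).sum r).2.1 :=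
    MvNEquiv.trans h1 ((p.sum q).sum r).2.2
      ((p.mvn_sum q).fromBlocks (MvNEquiv.refl r.2.2)) ((p.sum q).mvn_sum r)
  have h5 : MvNEquiv (Matrix.fromBlocks p.2.1 0 0 (Matrix.fromBlocks q.2.1 0 0 r.2.1))
      (p.sum (q.sum r)).2.1 :=
    MvNEquiv.trans h2 (p.sum (q.sum r)).2.2
      ((MvNEquiv.refl p.2.2).fromBlocks (q.mvn_sum r)) (p.mvn_sum (q.sum r))
  exact MvNEquiv.trans ((p.sum q).sum r).2.2 (p.sum (q.sum r)).2.2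
    (MvNEquiv.trans ((p.sum q).sum r).2.2 h2 h4.symm h3) h5

instance : AddCommSemigroup (MvN A) where
  add := Quotient.map₂ (sa := projSetoid A) (sb := projSetoid A) (sc := projSetoid A) Proj.sum
    fun _ _ h _ _ h' => Proj.sum_congr h h'
  add_assoc := by
    rintro ⟨p⟩ ⟨q⟩ ⟨r⟩
    exact Quotient.sound (s := projSetoid A) (Proj.sum_assoc p q r)
  add_comm := by
    rintro ⟨p⟩ ⟨q⟩
    exact Quotient.sound (s := projSetoid A) (Proj.sum_comm p q)

theorem MvN.mk_add_mk (p q : Proj A) : MvN.mk p + MvN.mk q = MvN.mk (p.sum q) := rfl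

instance : Nonempty (MvN A) := ⟨MvN.mk ⟨0, 0, .zero _⟩⟩

variable {B C : Type u} [CStarAlgebra B] [CStarAlgebra C]

theorem map_conjTranspose' (ψ : A →⋆ₙₐ[ℂ] B) (v : Matrix m n A) : (v.map ψ)ᴴ = vᴴ.map ψ :=
  (conjTranspose_map ψ (fun x => map_star ψ x)).symm

/-- The matrix amplification of a `*`-homomorphism, on projections. -/
def Proj.map (ψ : A →⋆ₙₐ[ℂ] B) (p : Proj A) : Proj B :=
  ⟨p.1, p.2.1.map ψ, by
    have h1 : (p.2.1)ᴴ = p.2.1 := p.2.2.isSelfAdjoint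
    have h2 : p.2.1 * p.2.1 = p.2.1 := p.2.2.isIdempotentElem
    constructor
    · rw [IsIdempotentElem, ← Matrix.map_mul, h2]
    · change (p.2.1.map ψ)ᴴ = _
      rw [map_conjTranspose', h1]⟩

/-- The semigroup homomorphism that a `*`-homomorphism induces: `[p] ↦ [ψ_n(p)]`. -/
def MvN.map (ψ : A →⋆ₙₐ[ℂ] B) : MvN A →ₙ+ MvN B where
  toFun := Quotient.map (sa := projSetoid A) (sb := projSetoid B) (Proj.map ψ) (by
    rintro p q ⟨v, hp, hq⟩
    refine ⟨v.map ψ, ?_, ?_⟩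
    · simp only [Proj.map]
      rw [map_conjTranspose', hp, Matrix.map_mul]
      rfl
    · simp only [Proj.map]
      rw [map_conjTranspose', hq, Matrix.map_mul]
      rfl)
  map_add' := by
    rintro ⟨p⟩ ⟨q⟩
    change MvN.mk (Proj.map ψ (p.sum q)) = MvN.mk ((Proj.map ψ p).sum (Proj.map ψ q))
    congr 1
    refine Sigma.ext rfl (heq_of_eq (Subtype.ext ?_))
    change ((Matrix.fromBlocks p.2.1 0 0 q.2.1).submatrix finSumFinEquiv.symm finSumFinEquiv.symm).map ψ
      = (Matrix.fromBlocks (p.2.1.map ψ) 0 0 (q.2.1.map ψ)).submatrix _ _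
    rw [← submatrix_map, fromBlocks_map]
    congr 2 <;> (ext; simp)

theorem MvN.map_id : MvN.map (NonUnitalStarAlgHom.id ℂ A) = AddHom.id (MvN A) := by
  ext x
  obtain ⟨p⟩ := x
  rfl

theorem MvN.map_comp (φ : A →⋆ₙₐ[ℂ] B) (ψ : B →⋆ₙₐ[ℂ] C) :
    MvN.map (ψ.comp φ) = (MvN.map ψ).comp (MvN.map φ) := by
  ext x
  obtain ⟨p⟩ := x
  rfl

variable (A) in
/-- A unital C*-algebra is stably finite if in every matrix algebra over it each isometry is
unitary. -/
def StablyFinite : Prop :=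
  ∀ (n : ℕ) (v : Matrix (Fin n) (Fin n) A), vᴴ * v = 1 → v * vᴴ = 1

/-! ### Computable points of matrix algebras -/

/-- The C*-norm of a matrix over `A`. -/
def cstarMatrixNorm {n : ℕ} (x : Matrix (Fin n) (Fin n) A) : ℝ :=
  letI := CStarAlgebra.spectralOrder A
  letI := CStarAlgebra.spectralOrderedRing A
  ‖CStarMatrix.ofMatrix x‖

/-- The special points of the presentation of the algebra of `n × n` matrices that the special
points `a` induce: the matrices with a single entry from `a`. -/
def matrixPoint (a : ℕ → A) (n : ℕ) (k : ℕ) : Matrix (Fin n) (Fin n) A :=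
  fun r s =>
    if (r : ℕ) = k.unpair.2.unpair.1 % n ∧ (s : ℕ) = k.unpair.2.unpair.2 % n then a k.unpair.1 else 0

/-- `c` is an index of `x` as a computable point of the induced presentation of the matrix algebra. -/
def IsMatrixIndex (P : CStarPresentation A) {n : ℕ} (x : Matrix (Fin n) (Fin n) A) (c : Code) :
    Prop :=
  ∀ k : ℕ, ∃ q : StarPoly, Outputs c k q ∧
    cstarMatrixNorm (x - q.eval (matrixPoint P.point n)) < (2 : ℝ)⁻¹ ^ k

end MurrayVonNeumann

/-! ### The Grothendieck group of an abelian semigroup -/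

section Grothendieck

/-- `(a, b) ∼ (c, d)` if and only if `a + d + z = c + b + z` for some `z`. -/
def grothCon (S : Type u) [AddCommSemigroup S] : AddCon (S × S) where
  r x y := ∃ z, x.1 + y.2 + z = y.1 + x.2 + z
  iseqv :=
    { refl := fun x => ⟨x.1, rfl⟩
      symm := fun ⟨z, h⟩ => ⟨z, h.symm⟩
      trans := by
        rintro ⟨a, b⟩ ⟨c, d⟩ ⟨e, f⟩ ⟨z, h⟩ ⟨w, h'⟩
        refine ⟨d + z + w, ?_⟩
        simp only at h h' ⊢
        calc a + f + (d + z + w) = (a + d + z) + (f + w) := by ac_rfl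
          _ = (c + f + w) + (b + z) := by rw [h]; ac_rfl
          _ = e + b + (d + z + w) := by rw [h']; ac_rfl }
  add' := by
    rintro ⟨a, b⟩ ⟨c, d⟩ ⟨a', b'⟩ ⟨c', d'⟩ ⟨z, h⟩ ⟨w, h'⟩
    refine ⟨z + w, ?_⟩
    simp only [Prod.mk_add_mk] at h h' ⊢
    calc a + a' + (d + d') + (z + w) = (a + d + z) + (a' + d' + w) := by ac_rfl
      _ = c + c' + (b + b') + (z + w) := by rw [h, h']; ac_rfl

/-- The Grothendieck group of an abelian semigroup. -/
def Groth (S : Type u) [AddCommSemigroup S] : Type u := (grothCon S).Quotient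

variable {S T R : Type u} [AddCommSemigroup S] [AddCommSemigroup T] [AddCommSemigroup R]

/-- The class of `(a, b)`, which is the formal difference of `a` and `b`. -/
def Groth.mk (a b : S) : Groth S := Quotient.mk (grothCon S).toSetoid (a, b)

theorem Groth.mk_eq_mk {a b c d : S} :
    Groth.mk a b = Groth.mk c d ↔ ∃ z, a + d + z = c + b + z := by
  exact Quotient.eq (r := (grothCon S).toSetoid)

theorem Groth.ind {p : Groth S → Prop} (h : ∀ a b, p (Groth.mk a b)) (x : Groth S) : p x := by
  obtain ⟨a, b⟩ := x
  exact h a b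

instance : AddCommSemigroup (Groth S) :=
  inferInstanceAs (AddCommSemigroup (grothCon S).Quotient)

theorem Groth.mk_add_mk (a b c d : S) : Groth.mk a b + Groth.mk c d = Groth.mk (a + c) (b + d) :=
  rfl

instance : Neg (Groth S) where
  neg := Quotient.map' (fun x => (x.2, x.1)) (by
    rintro ⟨a, b⟩ ⟨c, d⟩ ⟨z, h⟩
    refine ⟨z, ?_⟩
    simp only at h ⊢
    rw [add_comm b c, ← h, add_comm d a])

theorem Groth.neg_mk (a b : S) : -Groth.mk a b = Groth.mk b a := rfl

instance [Nonempty S] : Zero (Groth S) where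
  zero := Groth.mk (Classical.arbitrary S) (Classical.arbitrary S)

theorem Groth.zero_eq [Nonempty S] (a : S) : (0 : Groth S) = Groth.mk a a :=
  Groth.mk_eq_mk.2 ⟨a, by ac_rfl⟩

instance [Nonempty S] : AddCommGroup (Groth S) where
  zero_add := Groth.ind fun a b => by
    rw [Groth.zero_eq a, Groth.mk_add_mk]
    exact Groth.mk_eq_mk.2 ⟨a, by ac_rfl⟩
  add_zero := Groth.ind fun a b => by
    rw [Groth.zero_eq a, Groth.mk_add_mk]
    exact Groth.mk_eq_mk.2 ⟨a, by ac_rfl⟩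
  nsmul := nsmulRec
  zsmul := zsmulRec
  neg_add_cancel := Groth.ind fun a b => by
    rw [Groth.zero_eq a, Groth.neg_mk, Groth.mk_add_mk]
    exact Groth.mk_eq_mk.2 ⟨a, by ac_rfl⟩
  add_comm := add_comm

/-- The canonical map of `S` to its Grothendieck group, `a ↦ [(a + b, b)]` (for any `b`). -/
def Groth.of [Nonempty S] (a : S) : Groth S :=
  Groth.mk (a + Classical.arbitrary S) (Classical.arbitrary S)

theorem Groth.of_eq [Nonempty S] (a b : S) : Groth.of a = Groth.mk (a + b) b :=
  Groth.mk_eq_mk.2 ⟨a, by ac_rfl⟩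

variable [Nonempty S] [Nonempty T] [Nonempty R]

/-- The homomorphism of Grothendieck groups that a semigroup homomorphism induces. -/
def Groth.map (φ : S →ₙ+ T) : Groth S →+ Groth T :=
  AddMonoidHom.mk' (Quotient.map' (fun x => (φ x.1, φ x.2)) (by
    rintro ⟨a, b⟩ ⟨c, d⟩ ⟨z, h⟩
    refine ⟨φ z, ?_⟩
    simp only at h ⊢
    rw [← map_add, ← map_add, h, map_add, map_add])) (by
    refine Groth.ind fun a b => Groth.ind fun c d => ?_
    change Groth.mk (φ (a + c)) (φ (b + d)) = Groth.mk (φ a + φ c) (φ b + φ d)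
    rw [map_add, map_add])

theorem Groth.map_mk (φ : S →ₙ+ T) (a b : S) :
    Groth.map φ (Groth.mk a b) = Groth.mk (φ a) (φ b) := rfl

theorem Groth.map_of (φ : S →ₙ+ T) (a : S) : Groth.map φ (Groth.of a) = Groth.of (φ a) := by
  rw [Groth.of, Groth.map_mk, map_add, ← Groth.of_eq]

theorem Groth.map_id : Groth.map (AddHom.id S) = AddMonoidHom.id (Groth S) := by
  ext x
  induction x using Groth.ind with
  | h a b => rfl

theorem Groth.map_comp (φ : S →ₙ+ T) (ψ : T →ₙ+ R) :
    Groth.map (ψ.comp φ) = (Groth.map ψ).comp (Groth.map φ) := by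
  ext x
  induction x using Groth.ind with
  | h a b => rfl

end Grothendieck

/-! ### The group `K_0` and its positive cone -/

/-- The group `K_0(A)` of a unital C*-algebra: the Grothendieck group of the Murray-von Neumann
semigroup. -/
abbrev K0 (A : Type u) [CStarAlgebra A] : Type u := Groth (MvN A)

/-- The positive cone of `K_0(A)`: the image of the Murray-von Neumann semigroup. -/
def K0.positiveCone (A : Type u) [CStarAlgebra A] : Set (K0 A) :=
  {x | ∃ p : Proj A, x = Groth.of (MvN.mk p)}

/-! ### Functors between categories of presentations that lie over the functors above -/

/-- A functor `A^# ↦ D(A^#)`, `ψ ↦ D(ψ)` from c.e. presentations of C*-algebras to c.e. presentations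
of semigroups that lies over the functor `D`: a c.e. presentation of `D(A)` for each `A^#`, such that
the maps `D(ψ)` are computable. -/
structure MvNPresentations : Type (u + 1) where
  pres : ∀ X : CStarCE.{u}, SemigroupPresentation (MvN X.carrier)
  ce : ∀ X, (pres X).IsCE
  map_computable : ∀ {X Y : CStarCE.{u}} (ψ : X ⟶ Y), ∃ c,
    IsMapIndex (pres X).label (pres Y).label (MvN.map (CStarCE.hom ψ)) c

def MvNPresentations.functor (P : MvNPresentations.{u}) : CStarCE.{u} ⥤ AbSemigroupCE.{u} where
  obj X := ⟨MvN X.carrier, P.pres X, P.ce X⟩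
  map ψ := Subtype.mk (MvN.map (CStarCE.hom ψ)) (P.map_computable ψ)
  map_id _ := Subtype.ext MvN.map_id
  map_comp f g := Subtype.ext (MvN.map_comp (CStarCE.hom f) (CStarCE.hom g))

/-- A functor `S^# ↦ G(S^#)`, `φ ↦ G(φ)` from c.e. presentations of abelian semigroups to c.e.
presentations of abelian groups that lies over the Grothendieck functor `G`. -/
structure GrothPresentations : Type (u + 1) where
  pres : ∀ Y : AbSemigroupCE.{u}, GroupPresentation (Groth Y.carrier)
  ce : ∀ Y, (pres Y).IsCE
  map_computable : ∀ {X Y : AbSemigroupCE.{u}} (φ : X ⟶ Y), ∃ c,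
    IsMapIndex (pres X).label (pres Y).label (Groth.map (AbSemigroupCE.hom φ)) c

def GrothPresentations.functor (Q : GrothPresentations.{u}) : AbSemigroupCE.{u} ⥤ AbGroupCE.{u} where
  obj Y := ⟨Groth Y.carrier, Q.pres Y, Q.ce Y⟩
  map φ := Subtype.mk (Groth.map (AbSemigroupCE.hom φ)) (Q.map_computable φ)
  map_id _ := Subtype.ext Groth.map_id
  map_comp f g := Subtype.ext (Groth.map_comp (AbSemigroupCE.hom f) (AbSemigroupCE.hom g))

/-- The functor `K_0 = G ∘ D` on presentations. -/
def k0Functor (P : MvNPresentations.{u}) (Q : GrothPresentations.{u}) :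
    CStarCE.{u} ⥤ AbGroupCE.{u} :=
  P.functor ⋙ Q.functor

/-- The presentation `K_0(A^#)` of the group `K_0(A)`. -/
def k0Presentation (P : MvNPresentations.{u}) (Q : GrothPresentations.{u}) (X : CStarCE.{u}) :
    GroupPresentation (K0 X.carrier) :=
  ((k0Functor P Q).obj X).pres

/-- The presentations `D(A^#)` are computably supported by `A^#`, uniformly: given an index of `A^#` and
a word `w`, an algorithm computes `n` and an index of a projection in the algebra of `n × n`
matrices over `A` whose class has the label `w`. -/
def MvNPresentations.Supported (P : MvNPresentations.{u}) : Prop :=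
  ∃ s : Code × (ℕ × List ℕ) → ℕ × Code, Computable s ∧
    ∀ (X : CStarCE.{u}) (w : ℕ × List ℕ),
      ∃ p : {p : Matrix (Fin (s (X.index, w)).1) (Fin (s (X.index, w)).1) X.carrier //
          IsStarProjection p},
        IsMatrixIndex X.pres p.1 (s (X.index, w)).2 ∧ (P.pres X).label w = MvN.mk ⟨_, p⟩

/-- The canonical maps `γ_S` of the semigroups to their Grothendieck groups are computable
from `S^#` to `G(S^#)`, uniformly in an index of `S^#`. -/
def GrothPresentations.ComputableOf (Q : GrothPresentations.{u}) : Prop :=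
  ∃ g : Code → Code, Computable g ∧
    ∀ (Y : AbSemigroupCE.{u}) (e : Code), IsKernelIndex Y.pres.label e →
      IsMapIndex Y.pres.label (Q.pres Y).label Groth.of (g e)

end

end EffectiveK

open EffectiveK

/-!
The semigroup `D(A)` is presented by *almost projections*. A generator codes a size `n`, a
`*`-polynomial `x` over the matrix presentation and a computation which certifies that `h = x + x*`
satisfies `‖h² - h‖ < 1/32`; the norm of a matrix is bounded from above by the sum of the norms of its
entries, so an index of the presentation of `A` yields such certificates. The iteration
`h ↦ 3h² - 2h³` then converges to a projection with the explicit error `1/8 / 2 ^ j` after `j` steps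
(`exists_isStarProjection_of_newton`). Hence the projection is computable from the generator, and so is
the block-diagonal sum attached to a word; this is the uniform support of `D(A^#)` by `A^#`. Close
projections are equivalent, so every Murray-von Neumann class is labelled
(`exists_generatorProj_eq`).

Two projections `p`, `q` are equivalent as soon as `‖x x* - p‖` and `‖x* x - q‖` are at most `1/4` for
some `x`, since the polar part of `p x q` is then a partial isometry between them
(`exists_partialIsometry_of_almost`). By density a rational point `x` can be taken, so equality of
labels becomes the existence of a certificate (`mk_eq_mk_of_equivTest`, `exists_equivTest`), and the
search for one makes the kernel c.e. The same search, run on the entrywise image of an approximation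
under a computable `*`-homomorphism `ψ`, finds a label of `D(ψ)[p]`.

For the Grothendieck group, a word of the free group is split into its positive and its negative part,
and equality of formal differences is a search for the element `z` in `a + d + z = c + b + z`. The
positive cone is the set of elements that have a positive word as a label, hence c.e.

All algorithms are searches over primitive recursive predicates. Their uniformity in the indices comes
from the `s-m-n` theorem (`exists_search`).
-/

namespace EffectiveK

noncomputable section

/-! ### Bounded computations and unbounded search -/

section Search

variable {σ α τ β : Type} [Primcodable σ] [Primcodable α] [Primcodable τ] [Primcodable β]

/-- The output of the algorithm `c` on the input `a` if it is found within the time bound `k`. -/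
def run (k : ℕ) (c : Code) (a : α) : Option β :=
  (c.evaln k (Encodable.encode a)).bind Encodable.decode

theorem primrec_run {f : σ → ℕ} {g : σ → Code} {h : σ → α} (hf : Primrec f) (hg : Primrec g)
    (hh : Primrec h) : Primrec fun s => (run (f s) (g s) (h s) : Option β) :=
  Primrec.option_bind (Code.primrec_evaln.comp ((hf.pair hg).pair (Primrec.encode.comp hh)))
    (Primrec.decode.comp Primrec.snd).to₂

theorem eq_of_run_eq_some {c : Code} {a : α} {b b' : β} {k : ℕ} (h : Outputs c a b)
    (h' : run k c a = some b') : b' = b := by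
  obtain ⟨y, hy, hy'⟩ := Option.bind_eq_some_iff.1 h'
  have := Part.mem_unique (Code.evaln_sound hy) h
  subst this
  simpa using hy'.symm

theorem exists_run_eq_some {c : Code} {a : α} {b : β} (h : Outputs c a b) :
    ∃ k, ∀ l, k ≤ l → run l c a = some b := by
  obtain ⟨k, hk⟩ := Code.evaln_complete.1 h
  exact ⟨k, fun l hl => Option.bind_eq_some_iff.2 ⟨_, Code.evaln_mono hl hk, Encodable.encodek b⟩⟩

theorem mem_ceSet_iff {c : Code} {a : α} :
    a ∈ (ceSet c : Set α) ↔ ∃ k, (c.evaln k (Encodable.encode a)).isSome := by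
  change (c.eval _).Dom ↔ _
  rw [Part.dom_iff_mem]
  simp only [Code.evaln_complete, Option.isSome_iff_exists]
  exact exists_comm

theorem rePred_mem_ceSet (c : Code) : REPred fun a : α => a ∈ (ceSet c : Set α) :=
  (Code.eval_part.comp (Computable.const c) Computable.encode).dom_re

/-- Every partial computable function of a parameter and an input is given by a code that depends
computably on the parameter. -/
theorem exists_code_param {f : σ × α →. β} (hf : Partrec f) :
    ∃ g : σ → Code, Computable g ∧
      ∀ s a, (g s).eval (Encodable.encode a) = (f (s, a)).map Encodable.encode := by
  obtain ⟨c, hc⟩ := Code.exists_code.1 hf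
  refine ⟨fun s => Code.curry c (Encodable.encode s),
    (Code.primrec₂_curry.comp (Primrec.const c) Primrec.encode).to_comp, fun s a => ?_⟩
  rw [Code.eval_curry, hc]
  simp

theorem exists_code_total {f : σ × α → β} (hf : Computable f) :
    ∃ g : σ → Code, Computable g ∧ ∀ s a, Outputs (g s) a (f (s, a)) := by
  obtain ⟨g, hg, h⟩ := exists_code_param hf.partrec
  exact ⟨g, hg, fun s a => by simp [Outputs, h]⟩

/-- Unbounded search for a witness `t` such that `F s a t` has a value, as an algorithm whose index
depends computably on `s`. -/
theorem exists_search {F : (σ × α) × τ → Option β} (hF : Computable F) :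
    ∃ g : σ → Code, Computable g ∧ ∀ s a,
      (((g s).eval (Encodable.encode a)).Dom ↔ ∃ t b, F ((s, a), t) = some b) ∧
      ((∃ t b, F ((s, a), t) = some b) → ∃ t b, F ((s, a), t) = some b ∧ Outputs (g s) a b) := by
  let G : σ × α → ℕ → Option β := fun x n => (Encodable.decode (α := τ) n).bind fun t => F (x, t)
  have hG : Computable₂ G :=
    Computable.option_bind (Computable.decode.comp Computable.snd)
      (hF.comp ((Computable.fst.comp Computable.fst).pair Computable.snd)).to₂
  obtain ⟨g, hg, h⟩ := exists_code_param (Partrec.rfindOpt hG)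
  have key : ∀ x, (∃ n b, b ∈ G x n) ↔ ∃ t b, F (x, t) = some b := by
    intro x
    constructor
    · rintro ⟨n, b, hb⟩
      obtain ⟨t, -, ht⟩ := Option.bind_eq_some_iff.1 hb
      exact ⟨t, b, ht⟩
    · rintro ⟨t, b, hb⟩
      exact ⟨Encodable.encode t, b, Option.bind_eq_some_iff.2 ⟨t, Encodable.encodek t, hb⟩⟩
  have dom : ∀ x, (Nat.rfindOpt (G x)).Dom ↔ ∃ t b, F (x, t) = some b := fun x =>
    Nat.rfindOpt_dom.trans (key x)
  refine ⟨g, hg, fun s a => ⟨?_, fun hx => ?_⟩⟩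
  · rw [h]
    exact dom (s, a)
  · obtain ⟨b, hb⟩ := Part.dom_iff_mem.1 ((dom (s, a)).2 hx)
    obtain ⟨n, hn⟩ := Nat.rfindOpt_spec hb
    obtain ⟨t, -, ht⟩ := Option.bind_eq_some_iff.1 hn
    refine ⟨t, b, ht, ?_⟩
    rw [Outputs, h]
    exact Part.mem_map _ hb

/-- Unbounded search for a witness of a decidable property, as a c.e. set whose index depends
computably on the parameter. -/
theorem exists_ceSet {R : (σ × α) × τ → Prop} (hR : PrimrecPred R) :
    ∃ g : σ → Code, Computable g ∧ ∀ s, ceSet (g s) = {a : α | ∃ t, R ((s, a), t)} := by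
  classical
  have hF : Computable fun x : (σ × α) × τ => if R x then some () else none :=
    (Primrec.ite hR (Primrec.const _) (Primrec.const _)).to_comp
  obtain ⟨g, hg, h⟩ := exists_search hF
  refine ⟨g, hg, fun s => Set.ext fun a => (h s a).1.trans ?_⟩
  simp

end Search

/-! ### Compositional rules for primitive recursive functions -/

section PrimrecRules

variable {α β γ σ : Type} [Primcodable α] [Primcodable β] [Primcodable γ] [Primcodable σ]

attribute [fun_prop] Primrec Primrec.const Primrec.comp

@[fun_prop]
theorem primrec_id : Primrec fun a : α => a := Primrec.id

@[fun_prop]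
theorem primrec_prodMk {f : α → β} {g : α → γ} (hf : Primrec f) (hg : Primrec g) :
    Primrec fun a => (f a, g a) := hf.pair hg

@[fun_prop]
theorem primrec_fst {f : α → β × γ} (hf : Primrec f) : Primrec fun a => (f a).1 :=
  Primrec.fst.comp hf

@[fun_prop]
theorem primrec_snd {f : α → β × γ} (hf : Primrec f) : Primrec fun a => (f a).2 :=
  Primrec.snd.comp hf

@[fun_prop]
theorem primrec_add {f g : α → ℕ} (hf : Primrec f) (hg : Primrec g) :
    Primrec fun a => f a + g a := Primrec.nat_add.comp hf hg

@[fun_prop]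
theorem primrec_mul {f g : α → ℕ} (hf : Primrec f) (hg : Primrec g) :
    Primrec fun a => f a * g a := Primrec.nat_mul.comp hf hg

@[fun_prop]
theorem primrec_mod {f g : α → ℕ} (hf : Primrec f) (hg : Primrec g) :
    Primrec fun a => f a % g a := Primrec.nat_mod.comp hf hg

@[fun_prop]
theorem primrec_natPair {f g : α → ℕ} (hf : Primrec f) (hg : Primrec g) :
    Primrec fun a => Nat.pair (f a) (g a) := Primrec₂.natPair.comp hf hg

@[fun_prop]
theorem primrec_unpair {f : α → ℕ} (hf : Primrec f) : Primrec fun a => (f a).unpair :=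
  Primrec.unpair.comp hf

@[fun_prop]
theorem primrec_decideEq [DecidableEq β] {f g : α → β} (hf : Primrec f) (hg : Primrec g) :
    Primrec fun a => decide (f a = g a) :=
  Primrec.eq.decide.comp hf hg

@[fun_prop]
theorem primrec_decideLt {f g : α → ℕ} (hf : Primrec f) (hg : Primrec g) :
    Primrec fun a => decide (f a < g a) :=
  Primrec.nat_lt.decide.comp hf hg

@[fun_prop]
theorem primrec_and {f g : α → Bool} (hf : Primrec f) (hg : Primrec g) :
    Primrec fun a => f a && g a := Primrec.and.comp hf hg

@[fun_prop]
theorem primrec_not {f : α → Bool} (hf : Primrec f) : Primrec fun a => !f a :=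
  Primrec.not.comp hf

@[fun_prop]
theorem primrec_cond {c : α → Bool} {f g : α → β} (hc : Primrec c) (hf : Primrec f)
    (hg : Primrec g) : Primrec fun a => bif c a then f a else g a := Primrec.cond hc hf hg

@[fun_prop]
theorem primrec_some {f : α → β} (hf : Primrec f) : Primrec fun a => some (f a) :=
  Primrec.option_some.comp hf

@[fun_prop]
theorem primrec_isSome {f : α → Option β} (hf : Primrec f) : Primrec fun a => (f a).isSome :=
  Primrec.option_isSome.comp hf

@[fun_prop]
theorem primrec_getD {f : α → Option β} {g : α → β} (hf : Primrec f) (hg : Primrec g) :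
    Primrec fun a => (f a).getD (g a) := Primrec.option_getD.comp hf hg

@[fun_prop]
theorem primrec_optionBind {f : α → Option β} {g : α → β → Option γ} (hf : Primrec f)
    (hg : Primrec fun x : α × β => g x.1 x.2) : Primrec fun a => (f a).bind (g a) :=
  Primrec.option_bind hf hg

@[fun_prop]
theorem primrec_optionMap {f : α → Option β} {g : α → β → γ} (hf : Primrec f)
    (hg : Primrec fun x : α × β => g x.1 x.2) : Primrec fun a => (f a).map (g a) :=
  Primrec.option_map hf hg

@[fun_prop]
theorem primrec_listMap {f : α → List β} {g : α → β → γ} (hf : Primrec f)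
    (hg : Primrec fun x : α × β => g x.1 x.2) : Primrec fun a => (f a).map (g a) :=
  Primrec.list_map hf hg

@[fun_prop]
theorem primrec_listAppend {f g : α → List β} (hf : Primrec f) (hg : Primrec g) :
    Primrec fun a => f a ++ g a := Primrec.list_append.comp hf hg

@[fun_prop]
theorem primrec_listCons {f : α → β} {g : α → List β} (hf : Primrec f) (hg : Primrec g) :
    Primrec fun a => f a :: g a := Primrec.list_cons.comp hf hg

@[fun_prop]
theorem primrec_listRange {f : α → ℕ} (hf : Primrec f) : Primrec fun a => List.range (f a) :=
  Primrec.list_range.comp hf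

@[fun_prop]
theorem primrec_listFlatMap {f : α → List β} {g : α → β → List γ} (hf : Primrec f)
    (hg : Primrec fun x : α × β => g x.1 x.2) : Primrec fun a => (f a).flatMap (g a) :=
  Primrec.list_flatMap hf hg

@[fun_prop]
theorem primrec_listFoldl {f : α → List β} {g : α → γ} {h : α → γ → β → γ} (hf : Primrec f)
    (hg : Primrec g) (hh : Primrec fun x : α × γ × β => h x.1 x.2.1 x.2.2) :
    Primrec fun a => (f a).foldl (h a) (g a) :=
  Primrec.list_foldl hf hg hh.to₂

@[fun_prop]
theorem primrec_listAll {f : α → List β} {g : α → β → Bool} (hf : Primrec f)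
    (hg : Primrec fun x : α × β => g x.1 x.2) : Primrec fun a => (f a).all (g a) := by
  have h : Primrec fun a => (f a).foldl (fun b x => b && g a x) true := by fun_prop
  refine h.of_eq fun a => ?_
  have : ∀ (l : List β) (b : Bool), l.foldl (fun b x => b && g a x) b = (b && l.all (g a)) := by
    intro l
    induction l with
    | nil => simp
    | cons x l ih => intro b; simp [ih, Bool.and_assoc]
  simpa using this (f a) true

@[fun_prop]
theorem primrec_iterate {f : α → ℕ} {g : α → β} {h : β → β} (hf : Primrec f) (hg : Primrec g)
    (hh : Primrec h) : Primrec fun a => h^[f a] (g a) :=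
  Primrec.nat_iterate hf hg (hh.comp Primrec.snd).to₂

attribute [fun_prop] primrec_run

end PrimrecRules

/-! ### Effective arithmetic of `*`-polynomials -/

namespace RatCode

/-- A code of the product of two rational numbers. -/
def mul (s t : RatCode) : RatCode :=
  (s.1 * t.1 + s.2.1 * t.2.1, s.1 * t.2.1 + s.2.1 * t.1, s.2.2 * t.2.2 + s.2.2 + t.2.2)

/-- A code of the sum of two rational numbers. -/
def add (s t : RatCode) : RatCode :=
  (s.1 * (t.2.2 + 1) + t.1 * (s.2.2 + 1), s.2.1 * (t.2.2 + 1) + t.2.1 * (s.2.2 + 1),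
    s.2.2 * t.2.2 + s.2.2 + t.2.2)

/-- A code of the negative of a rational number. -/
def neg (s : RatCode) : RatCode := (s.2.1, s.1, s.2.2)

theorem val_mul (s t : RatCode) : (mul s t).val = s.val * t.val := by
  simp only [val, mul]
  push_cast
  have h1 : (s.2.2 : ℚ) + 1 ≠ 0 := by positivity
  have h2 : (t.2.2 : ℚ) + 1 ≠ 0 := by positivity
  rw [div_mul_div_comm]
  congr 1 <;> ring

theorem val_add (s t : RatCode) : (add s t).val = s.val + t.val := by
  simp only [val, add]
  push_cast
  have h1 : (s.2.2 : ℚ) + 1 ≠ 0 := by positivity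
  have h2 : (t.2.2 : ℚ) + 1 ≠ 0 := by positivity
  rw [div_add_div _ _ h1 h2]
  congr 1 <;> ring

theorem val_neg (s : RatCode) : (neg s).val = -s.val := by
  simp only [val, neg]
  ring

theorem exists_val_eq (q : ℚ) : ∃ t : RatCode, t.val = q := by
  refine ⟨(q.num.toNat, (-q.num).toNat, q.den - 1), ?_⟩
  have h : ((q.den - 1 : ℕ) : ℚ) + 1 = q.den := by
    rw [Nat.cast_sub q.den_pos]; simp
  have h' : ((q.num.toNat : ℚ) - (-q.num).toNat) = q.num := by
    exact_mod_cast q.num.toNat_sub_toNat_neg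
  simp only [val]
  rw [h, h', Rat.num_div_den]

end RatCode

/-- The complex number with a given code of its real and imaginary parts. -/
def coeffVal (t : RatCode × RatCode) : ℂ := ⟨(t.1.val : ℝ), (t.2.val : ℝ)⟩

/-- A code of the product of two elements of `ℚ(i)`. -/
def coeffMul (s t : RatCode × RatCode) : RatCode × RatCode :=
  (.add (.mul s.1 t.1) (.neg (.mul s.2 t.2)), .add (.mul s.1 t.2) (.mul s.2 t.1))

/-- A code of the complex conjugate. -/
def coeffStar (s : RatCode × RatCode) : RatCode × RatCode := (s.1, .neg s.2)

theorem coeffVal_mul (s t : RatCode × RatCode) :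
    coeffVal (coeffMul s t) = coeffVal s * coeffVal t := by
  apply Complex.ext <;> simp [coeffVal, coeffMul, RatCode.val_add, RatCode.val_mul,
    RatCode.val_neg, sub_eq_add_neg]

theorem coeffVal_star (s : RatCode × RatCode) : coeffVal (coeffStar s) = star (coeffVal s) := by
  apply Complex.ext <;> simp [coeffVal, coeffStar, RatCode.val_neg]

/-- The adjoint of a letter. -/
def Letter.flip (l : Letter) : Letter := (l.1, !l.2)

namespace StarPoly

/-- The product of two `*`-polynomials. -/
def mul (p q : StarPoly) : StarPoly :=
  p.flatMap fun t => q.map fun u => (coeffMul t.1 u.1, t.2.1, t.2.2 ++ u.2.1 :: u.2.2)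

/-- The multiple of a `*`-polynomial by a scalar. -/
def scale (c : RatCode × RatCode) (p : StarPoly) : StarPoly :=
  p.map fun t => (coeffMul c t.1, t.2.1, t.2.2)

/-- The adjoint of a monomial `l w` has the letters reversed and starred; the head of the reversed
word is carried along in the fold. -/
def starWord (l : Letter) (w : List Letter) : Letter × List Letter :=
  w.foldl (fun s m => (m.flip, s.1 :: s.2)) (l.flip, [])

def conj (p : StarPoly) : StarPoly :=
  p.map fun t => (coeffStar t.1, starWord t.2.1 t.2.2)

/-- Substitution of letters, which may treat the first letter of a word differently. -/
def subst (f g : Letter → Letter) (p : StarPoly) : StarPoly :=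
  p.map fun t => (t.1, f t.2.1, t.2.2.map g)

/-- The difference of two `*`-polynomials. -/
def sub (p q : StarPoly) : StarPoly := p ++ scale ((0, 1, 0), (0, 0, 0)) q

/-- `h ↦ 3h² - 2h³`. -/
def newton (h : StarPoly) : StarPoly :=
  sub (scale ((3, 0, 0), (0, 0, 0)) (mul h h)) (scale ((2, 0, 0), (0, 0, 0)) (mul (mul h h) h))

section Word

variable {R : Type u} [NonUnitalRing R] [StarRing R]

theorem evalWord_append (a : ℕ → R) (l m : Letter) (w v : List Letter) :
    evalWord a l (w ++ m :: v) = evalWord a l w * evalWord a m v := by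
  have key : ∀ (v : List Letter) (x y : R), v.foldl (fun x m => x * evalLetter a m) (x * y) =
      x * v.foldl (fun x m => x * evalLetter a m) y := by
    intro v
    induction v with
    | nil => simp
    | cons m v ih => intro x y; simp only [List.foldl_cons]; rw [mul_assoc, ih]
  rw [evalWord, List.foldl_append, List.foldl_cons, key]
  rfl

theorem evalWord_concat (a : ℕ → R) (l m : Letter) (w : List Letter) :
    evalWord a l (w ++ [m]) = evalWord a l w * evalLetter a m :=
  evalWord_append a l m w []

theorem evalWord_cons (a : ℕ → R) (l m : Letter) (w : List Letter) :
    evalWord a l (m :: w) = evalLetter a l * evalWord a m w :=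
  evalWord_append a l m [] w

theorem evalLetter_flip (a : ℕ → R) (l : Letter) :
    evalLetter a l.flip = star (evalLetter a l) := by
  obtain ⟨i, b⟩ := l
  cases b <;> simp [evalLetter, Letter.flip]

theorem evalWord_starWord (a : ℕ → R) (l : Letter) (w : List Letter) :
    evalWord a (starWord l w).1 (starWord l w).2 = star (evalWord a l w) := by
  induction w using List.reverseRecOn with
  | nil => exact evalLetter_flip a l
  | append_singleton w m ih =>
    have : starWord l (w ++ [m]) = (m.flip, (starWord l w).1 :: (starWord l w).2) := by
      simp [starWord]
    rw [this, evalWord_concat, star_mul, ← ih, ← evalLetter_flip, evalWord_cons]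

end Word

section Eval

variable {R : Type u} [NonUnitalRing R] [StarRing R] [Module ℂ R]

theorem eval_nil (a : ℕ → R) : StarPoly.eval ([] : StarPoly) a = 0 := by simp [eval]

theorem eval_cons (a : ℕ → R) (t) (p : StarPoly) :
    StarPoly.eval (t :: p) a = coeffVal t.1 • evalWord a t.2.1 t.2.2 + p.eval a := by
  simp [eval, coeffVal]

theorem eval_append (a : ℕ → R) (p q : StarPoly) :
    StarPoly.eval (p ++ q : StarPoly) a = p.eval a + q.eval a := by simp [eval]

theorem eval_flatMap {β : Type} (a : ℕ → R) (l : List β) (f : β → StarPoly) :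
    StarPoly.eval (l.flatMap f : StarPoly) a = (l.map fun x => (f x).eval a).sum := by
  induction l with
  | nil => simp [eval_nil]
  | cons x l ih => rw [List.flatMap_cons, eval_append, ih]; simp

theorem eval_scale (a : ℕ → R) (c) (p : StarPoly) :
    (scale c p).eval a = coeffVal c • p.eval a := by
  induction p with
  | nil => simp [scale, eval_nil]
  | cons t p ih =>
    have : scale c (t :: p) = (coeffMul c t.1, t.2.1, t.2.2) :: scale c p := rfl
    rw [this, eval_cons, eval_cons, ih, smul_add, coeffVal_mul, mul_smul]

theorem coeffVal_natCast (n : ℕ) : coeffVal ((n, 0, 0), (0, 0, 0)) = n := by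
  apply Complex.ext <;> simp [coeffVal, RatCode.val]

theorem eval_sub (a : ℕ → R) (p q : StarPoly) : (sub p q).eval a = p.eval a - q.eval a := by
  have : coeffVal ((0, 1, 0), (0, 0, 0)) = -1 := by
    apply Complex.ext <;> simp [coeffVal, RatCode.val]
  rw [sub, eval_append, eval_scale, this]
  simp [sub_eq_add_neg]

theorem eval_conj [StarModule ℂ R] (a : ℕ → R) (p : StarPoly) :
    (conj p).eval a = star (p.eval a) := by
  induction p with
  | nil => simp [conj, eval_nil]
  | cons t p ih =>
    have : conj (t :: p) = (coeffStar t.1, starWord t.2.1 t.2.2) :: conj p := rfl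
    rw [this, eval_cons, eval_cons, ih, star_add, coeffVal_star, star_smul]
    simp only [evalWord_starWord]

theorem eval_subst {S : Type u} [NonUnitalRing S] [StarRing S] [Module ℂ S] {a : ℕ → R}
    {b : ℕ → S} {f g : Letter → Letter} (φ : R →ₗ[ℂ] S)
    (hf : ∀ l, evalLetter b (f l) = φ (evalLetter a l))
    (hg : ∀ x l, φ x * evalLetter b (g l) = φ (x * evalLetter a l)) (p : StarPoly) :
    (subst f g p).eval b = φ (p.eval a) := by
  have hw : ∀ l w, evalWord b (f l) (w.map g) = φ (evalWord a l w) := by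
    intro l w
    induction w using List.reverseRecOn with
    | nil => exact hf l
    | append_singleton w m ih =>
      rw [List.map_append, List.map_cons, List.map_nil, evalWord_concat, evalWord_concat, ih, hg]
  induction p with
  | nil => simp [subst, eval_nil]
  | cons t p ih =>
    have : subst f g (t :: p) = (t.1, f t.2.1, t.2.2.map g) :: subst f g p := rfl
    rw [this, eval_cons, eval_cons, ih, hw, map_add, map_smul]

variable [IsScalarTower ℂ R R] [SMulCommClass ℂ R R]

theorem eval_mul (a : ℕ → R) (p q : StarPoly) : (mul p q).eval a = p.eval a * q.eval a := by
  have h1 : ∀ t : (RatCode × RatCode) × Letter × List Letter, StarPoly.eval (q.map fun u =>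
      (coeffMul t.1 u.1, t.2.1, t.2.2 ++ u.2.1 :: u.2.2) : StarPoly) a
      = coeffVal t.1 • evalWord a t.2.1 t.2.2 * q.eval a := by
    intro t
    induction q with
    | nil => simp [eval_nil]
    | cons u q ih =>
      rw [List.map_cons, eval_cons, eval_cons, ih, coeffVal_mul, mul_add, evalWord_append,
        mul_smul, smul_mul_smul_comm, mul_smul]
  rw [mul, eval_flatMap]
  simp only [h1]
  rw [List.sum_map_mul_right]
  rfl

theorem eval_newton (a : ℕ → R) (h : StarPoly) : (newton h).eval a =
    (3 : ℂ) • (h.eval a * h.eval a) - (2 : ℂ) • (h.eval a * h.eval a * h.eval a) := by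
  have h3 := coeffVal_natCast 3
  have h2 := coeffVal_natCast 2
  rw [newton, eval_sub, eval_scale, eval_scale, eval_mul, eval_mul, eval_mul, h2, h3]
  norm_cast

end Eval

end StarPoly

section PrimrecPoly

variable {α : Type} [Primcodable α]

@[fun_prop]
theorem primrec_coeffMul {f g : α → RatCode × RatCode} (hf : Primrec f) (hg : Primrec g) :
    Primrec fun a => coeffMul (f a) (g a) := by
  unfold coeffMul RatCode.add RatCode.mul RatCode.neg
  fun_prop

@[fun_prop]
theorem primrec_coeffStar {f : α → RatCode × RatCode} (hf : Primrec f) :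
    Primrec fun a => coeffStar (f a) := by
  unfold coeffStar RatCode.neg
  fun_prop

@[fun_prop]
theorem primrec_flip {f : α → Letter} (hf : Primrec f) : Primrec fun a => (f a).flip := by
  unfold Letter.flip
  fun_prop

namespace StarPoly

@[fun_prop]
theorem primrec_mul {f g : α → StarPoly} (hf : Primrec f) (hg : Primrec g) :
    Primrec fun a => mul (f a) (g a) := by
  unfold mul
  fun_prop

@[fun_prop]
theorem primrec_scale {c : α → RatCode × RatCode} {f : α → StarPoly} (hc : Primrec c)
    (hf : Primrec f) : Primrec fun a => scale (c a) (f a) := by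
  unfold scale
  fun_prop

@[fun_prop]
theorem primrec_conj {f : α → StarPoly} (hf : Primrec f) : Primrec fun a => conj (f a) := by
  unfold conj starWord
  fun_prop

@[fun_prop]
theorem primrec_subst {f g : α → Letter → Letter} {p : α → StarPoly}
    (hf : Primrec fun x : α × Letter => f x.1 x.2) (hg : Primrec fun x : α × Letter => g x.1 x.2)
    (hp : Primrec p) : Primrec fun a => subst (f a) (g a) (p a) := by
  unfold subst
  fun_prop

@[fun_prop]
theorem primrec_sub {f g : α → StarPoly} (hf : Primrec f) (hg : Primrec g) :
    Primrec fun a => sub (f a) (g a) := by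
  unfold sub
  fun_prop

@[fun_prop]
theorem primrec_newton {f : α → StarPoly} (hf : Primrec f) : Primrec fun a => newton (f a) := by
  unfold newton
  fun_prop

end StarPoly

end PrimrecPoly

/-! ### Almost projections and almost partial isometries in C*-algebras -/

section CStar

variable {B : Type u} [CStarAlgebra B]

theorem norm_one_le_one : ‖(1 : B)‖ ≤ 1 := by
  rcases subsingleton_or_nontrivial B with h | h
  · rw [Subsingleton.elim (1 : B) 0, norm_zero]
    exact zero_le_one
  · exact CStarRing.norm_one.le

theorem IsStarProjection.norm_le_one {p : B} (hp : IsStarProjection p) : ‖p‖ ≤ 1 := by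
  have h : ‖p‖ * ‖p‖ = ‖p‖ := by
    rw [← CStarRing.norm_star_mul_self, hp.isSelfAdjoint.star_eq, hp.isIdempotentElem.eq]
  nlinarith [norm_nonneg p]

/-- The iteration `h ↦ 3h² - 2h³`, started at an almost idempotent self-adjoint element, converges
to a projection, with an explicit rate. The defects `e = h² - h` satisfy `e' = 4e³ - 3e²`, and the
steps are `-(2h - 1)e`, where `(2h - 1)² = 4e + 1`. -/
theorem exists_isStarProjection_of_newton {h : ℕ → B} (h0 : IsSelfAdjoint (h 0))
    (hd : ‖h 0 * h 0 - h 0‖ ≤ 1 / 32)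
    (hs : ∀ j, h (j + 1) = (3 : ℂ) • (h j * h j) - (2 : ℂ) • (h j * h j * h j)) :
    ∃ p, IsStarProjection p ∧ ∀ j, ‖p - h j‖ ≤ 1 / 8 / 2 ^ j := by
  have hs' : ∀ j, h (j + 1) = 3 * (h j * h j) - 2 * (h j * h j * h j) := by
    intro j
    rw [hs, ofNat_smul_eq_nsmul ℂ 3, ofNat_smul_eq_nsmul ℂ 2]
    simp only [nsmul_eq_mul, Nat.cast_ofNat]
  have hsa : ∀ j, IsSelfAdjoint (h j) := by
    intro j
    induction j with
    | zero => exact h0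
    | succ j ih =>
      rw [IsSelfAdjoint, hs]
      simp [ih.star_eq, mul_assoc]
  have he : ∀ j, h (j + 1) * h (j + 1) - h (j + 1) =
      4 * ((h j * h j - h j) * (h j * h j - h j) * (h j * h j - h j)) -
        3 * ((h j * h j - h j) * (h j * h j - h j)) := by
    intro j
    rw [hs']
    noncomm_ring
  have hstep : ∀ j, h (j + 1) - h j = -((2 * h j - 1) * (h j * h j - h j)) := by
    intro j
    rw [hs']
    noncomm_ring
  have hn4 : ∀ x : B, ‖4 * x‖ ≤ 4 * ‖x‖ := fun x => by
    have : (4 : B) * x = (4 : ℂ) • x := by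
      rw [ofNat_smul_eq_nsmul]; simp [nsmul_eq_mul]
    rw [this, norm_smul]; simp
  have hn3 : ∀ x : B, ‖3 * x‖ ≤ 3 * ‖x‖ := fun x => by
    have : (3 : B) * x = (3 : ℂ) • x := by
      rw [ofNat_smul_eq_nsmul]; simp [nsmul_eq_mul]
    rw [this, norm_smul]; simp
  have hE : ∀ j, ‖h j * h j - h j‖ ≤ 1 / 32 / 2 ^ j := by
    intro j
    induction j with
    | zero => simpa using hd
    | succ j ih =>
      rw [he]
      set e := h j * h j - h j
      have h1 : ‖e‖ ≤ 1 / 32 := ih.trans (div_le_self (by norm_num) (one_le_pow₀ (by norm_num)))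
      have h2 : ‖e * e‖ ≤ ‖e‖ * ‖e‖ := norm_mul_le _ _
      have h3 : ‖e * e * e‖ ≤ ‖e‖ * ‖e‖ * ‖e‖ :=
        (norm_mul_le _ _).trans (mul_le_mul_of_nonneg_right h2 (norm_nonneg _))
      have h4 := norm_sub_le (4 * (e * e * e)) (3 * (e * e))
      have h5 := hn4 (e * e * e)
      have h6 := hn3 (e * e)
      have h7 : ‖e‖ * ‖e‖ ≤ 1 / 32 * ‖e‖ := mul_le_mul_of_nonneg_right h1 (norm_nonneg _)
      have h8 : ‖e‖ * ‖e‖ * ‖e‖ ≤ 1 / 32 * ‖e‖ * (1 / 32) :=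
        mul_le_mul h7 h1 (norm_nonneg _) (by positivity)
      have h9 : (1 : ℝ) / 32 / 2 ^ (j + 1) = (1 / 32 / 2 ^ j) / 2 := by
        rw [pow_succ]; field_simp
      rw [h9]
      linarith [norm_nonneg e]
  have hT : ∀ j, ‖2 * h j - 1‖ ≤ 2 := by
    intro j
    have hE' : ‖h j * h j - h j‖ ≤ 1 / 32 :=
      (hE j).trans (div_le_self (by norm_num) (one_le_pow₀ (by norm_num)))
    have h1 : star (2 * h j - 1) * (2 * h j - 1) = 4 * (h j * h j - h j) + 1 := by
      rw [star_sub, star_mul, (hsa j).star_eq, star_one, star_ofNat]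
      noncomm_ring
    have h2 : ‖2 * h j - 1‖ * ‖2 * h j - 1‖ ≤ 2 := by
      rw [← CStarRing.norm_star_mul_self, h1]
      have := norm_add_le (4 * (h j * h j - h j)) 1
      linarith [hn4 (h j * h j - h j), norm_one_le_one (B := B)]
    nlinarith [norm_nonneg (2 * h j - 1)]
  have hdist : ∀ j, dist (h j) (h (j + 1)) ≤ 1 / 8 / 2 / 2 ^ j := by
    intro j
    rw [dist_comm, dist_eq_norm, hstep, norm_neg]
    calc _ ≤ ‖2 * h j - 1‖ * ‖h j * h j - h j‖ := norm_mul_le _ _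
      _ ≤ 2 * (1 / 32 / 2 ^ j) := mul_le_mul (hT j) (hE j) (norm_nonneg _) zero_le_two
      _ = _ := by ring
  obtain ⟨p, hp⟩ := cauchySeq_tendsto_of_complete (cauchySeq_of_le_geometric_two hdist)
  refine ⟨p, ⟨?_, ?_⟩, fun j => ?_⟩
  · have h1 : Tendsto (fun j => h j * h j - h j) atTop (𝓝 (p * p - p)) := (hp.mul hp).sub hp
    have h2 : Tendsto (fun j => h j * h j - h j) atTop (𝓝 0) := by
      refine squeeze_zero_norm hE ?_
      simpa [div_eq_mul_inv] using
        (tendsto_pow_atTop_nhds_zero_of_lt_one (by norm_num : (0 : ℝ) ≤ 2⁻¹)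
          (by norm_num)).const_mul (32⁻¹ : ℝ)
    exact sub_eq_zero.1 (tendsto_nhds_unique h1 h2)
  · have h1 : Tendsto (fun j => star (h j)) atTop (𝓝 (star p)) := hp.star
    simp only [(hsa _).star_eq] at h1
    exact tendsto_nhds_unique h1 hp
  · have := dist_le_of_le_geometric_two_of_tendsto hdist hp j
    rwa [dist_comm, dist_eq_norm] at this

/-- If `x` almost implements an equivalence of the projections `p` and `q`, then `y = p x q` has an
invertible `y*y + (1 - q)`, and the polar part of `y` implements an equivalence. -/
theorem exists_partialIsometry_of_almost {p q x : B} (hp : IsStarProjection p)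
    (hq : IsStarProjection q) (hxp : ‖x * star x - p‖ ≤ 1 / 4) (hxq : ‖star x * x - q‖ ≤ 1 / 4) :
    ∃ v, p = v * star v ∧ q = star v * v := by
  -- Both corners are treated by one estimate, applied to `x` and to `star x`.
  have key : ∀ {p q x : B}, IsStarProjection p → IsStarProjection q →
      ‖x * star x - p‖ ≤ 1 / 4 → ‖star x * x - q‖ ≤ 1 / 4 →
      IsUnit (star (p * x * q) * (p * x * q) + (1 - q)) := by
    intro p q x hp hq hxp hxq
    have hp1 := IsStarProjection.norm_le_one hp
    have hq1 := IsStarProjection.norm_le_one hq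
    have hpp : p * p = p := hp.isIdempotentElem
    have hqq : q * q = q := hq.isIdempotentElem
    have hxx : ‖star x * x‖ ≤ 5 / 4 := by
      have := norm_add_le (star x * x - q) q
      rw [sub_add_cancel] at this
      linarith
    have h1 : star (p * x * q) * (p * x * q) + (1 - q) =
        1 - q * (star x * (x * star x - p) * x - ((star x * x - q) * (star x * x) +
          q * (star x * x - q))) * q := by
      rw [star_mul, star_mul, hp.isSelfAdjoint.star_eq, hq.isSelfAdjoint.star_eq]
      have e1 : q * (star x * p) * (p * x * q) = q * (star x * p * x) * q := by
        have : q * (star x * p) * (p * x * q) = q * (star x * (p * p) * x) * q := by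
          simp only [mul_assoc]
        rw [this, hpp]
      have e2 : q * (star x * (x * star x - p) * x - ((star x * x - q) * (star x * x) +
          q * (star x * x - q))) * q = q * q * q * q - q * (star x * p * x) * q := by
        noncomm_ring
      rw [e1, e2, hqq, hqq, hqq]
      noncomm_ring
    rw [h1]
    apply isUnit_one_sub_of_norm_lt_one
    have h2 : ‖star x * (x * star x - p) * x‖ ≤ 5 / 16 := by
      have h3 : ‖star x‖ * ‖x‖ ≤ 5 / 4 := by
        rw [norm_star, ← CStarRing.norm_star_mul_self]; exact hxx
      calc _ ≤ ‖star x * (x * star x - p)‖ * ‖x‖ := norm_mul_le _ _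
        _ ≤ ‖star x‖ * ‖x * star x - p‖ * ‖x‖ :=
          mul_le_mul_of_nonneg_right (norm_mul_le _ _) (norm_nonneg _)
        _ = ‖x * star x - p‖ * (‖star x‖ * ‖x‖) := by ring
        _ ≤ 1 / 4 * (5 / 4) := mul_le_mul hxp h3 (by positivity) (by norm_num)
        _ = 5 / 16 := by norm_num
    have h3 : ‖(star x * x - q) * (star x * x)‖ ≤ 1 / 4 * (5 / 4) :=
      (norm_mul_le _ _).trans (mul_le_mul hxq hxx (norm_nonneg _) (by norm_num))
    have h4 : ‖q * (star x * x - q)‖ ≤ 1 * (1 / 4) :=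
      (norm_mul_le _ _).trans (mul_le_mul hq1 hxq (norm_nonneg _) (by norm_num))
    set w := star x * (x * star x - p) * x - ((star x * x - q) * (star x * x) +
          q * (star x * x - q))
    have h5 : ‖w‖ ≤ 5 / 16 + (1 / 4 * (5 / 4) + 1 * (1 / 4)) :=
      (norm_sub_le _ _).trans (add_le_add h2 ((norm_add_le _ _).trans (add_le_add h3 h4)))
    calc ‖q * w * q‖ ≤ ‖q * w‖ * ‖q‖ := norm_mul_le _ _
      _ ≤ (‖q‖ * ‖w‖) * ‖q‖ := mul_le_mul_of_nonneg_right (norm_mul_le _ _) (norm_nonneg _)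
      _ ≤ (1 * ‖w‖) * 1 := by gcongr
      _ < 1 := by linarith
  let _ := CStarAlgebra.spectralOrder B
  let _ := CStarAlgebra.spectralOrderedRing B
  have hpp : p * p = p := hp.isIdempotentElem
  have hqq : q * q = q := hq.isIdempotentElem
  have hps : star p = p := hp.isSelfAdjoint
  have hqs : star q = q := hq.isSelfAdjoint
  obtain ⟨y, hy⟩ : ∃ y, y = p * x * q := ⟨_, rfl⟩
  have hyq : y * q = y := by rw [hy, mul_assoc, hqq]
  have hpy : p * y = y := by rw [hy, ← mul_assoc, ← mul_assoc, hpp]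
  have hzu : IsUnit (star y * y + (1 - q)) := hy ▸ key hp hq hxp hxq
  have hwu : IsUnit (y * star y + (1 - p)) := by
    have := key (x := star x) hq hp (by rwa [star_star]) (by rwa [star_star])
    have e : star y = q * star x * p := by rw [hy, star_mul, star_mul, hps, hqs, mul_assoc]
    rwa [← e, star_star] at this
  obtain ⟨z, hz⟩ : ∃ z, z = star y * y + (1 - q) := ⟨_, rfl⟩
  obtain ⟨w, hw⟩ : ∃ w, w = y * star y + (1 - p) := ⟨_, rfl⟩
  rw [← hz] at hzu
  rw [← hw] at hwu
  have hz0 : 0 ≤ z := by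
    rw [hz]
    have h1 : 1 - q = star (1 - q) * (1 - q) := by
      rw [star_sub, star_one, hqs]
      have : (1 - q) * (1 - q) = 1 - q - q + q * q := by noncomm_ring
      rw [this, hqq]; abel
    rw [h1]
    exact add_nonneg (star_mul_self_nonneg _) (star_mul_self_nonneg _)
  have htt := CFC.sqrt_mul_sqrt_self z hz0
  have ht0 := CFC.sqrt_nonneg z
  have htu : IsUnit (CFC.sqrt z) := (CFC.isUnit_sqrt_iff z hz0).2 hzu
  set t := CFC.sqrt z
  have hts : star t = t := (IsSelfAdjoint.of_nonneg ht0).star_eq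
  have ht1 : IsUnit (t + 1) :=
    CStarAlgebra.isUnit_of_le 1 (le_add_of_nonneg_left ht0) isStrictlyPositive_one
  have hqt : (1 - q) * t = 1 - q := by
    have h1 : (1 - q) * z = 1 - q := by
      have e : q * star y = star y := by
        have := congrArg star hyq
        rwa [star_mul, hqs] at this
      have : (1 - q) * (star y * y + (1 - q)) =
        star y * y - q * star y * y + (1 - q - q + q * q) := by noncomm_ring
      rw [hz, this, e, hqq]
      abel
    have h2 : ((1 - q) * (t - 1)) * (t + 1) = 0 := by
      have : ((1 - q) * (t - 1)) * (t + 1) = (1 - q) * (t * t) - (1 - q) := by noncomm_ring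
      rw [this, htt, h1, sub_self]
    have h3 := (ht1.mul_left_eq_zero).1 h2
    rw [mul_sub, mul_one] at h3
    exact sub_eq_zero.1 h3
  have htq : t * (1 - q) = 1 - q := by
    have := congrArg star hqt
    rwa [star_mul, hts, star_sub, star_one, hqs] at this
  obtain ⟨T, hT⟩ := htu
  have hTs : star (↑T⁻¹ : B) = ↑T⁻¹ := by
    have : star (T : B) = T := by rw [hT, hts]
    have h1 : star T = T := Units.ext (by rw [Units.coe_star, this])
    rw [← Units.coe_star_inv, h1]
  have hTl : t * (↑T⁻¹ : B) = 1 := by rw [← hT]; exact T.mul_inv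
  have hTr : (↑T⁻¹ : B) * t = 1 := by rw [← hT]; exact T.inv_mul
  refine ⟨y * ↑T⁻¹, ?_, ?_⟩
  · have hyz : y * z = w * y := by
      rw [hz, hw]
      have e1 : y * (star y * y + (1 - q)) = y * star y * y + (y - y * q) := by noncomm_ring
      have e2 : (y * star y + (1 - p)) * y = y * star y * y + (y - p * y) := by noncomm_ring
      rw [e1, e2, hyq, hpy]
    apply hwu.mul_left_cancel
    rw [star_mul, hTs]
    calc w * p = y * star y := by
          have e : star y * p = star y := by
            have := congrArg star hpy
            rwa [star_mul, hps] at this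
          have : (y * star y + (1 - p)) * p = y * (star y * p) + (p - p * p) := by noncomm_ring
          rw [hw, this, e, hpp, sub_self, add_zero]
      _ = y * (t * (t * ↑T⁻¹) * ↑T⁻¹) * star y := by rw [hTl, mul_one, hTl, mul_one]
      _ = y * z * (↑T⁻¹ * ↑T⁻¹) * star y := by rw [← htt]; noncomm_ring
      _ = w * (y * ↑T⁻¹ * (↑T⁻¹ * star y)) := by rw [hyz]; noncomm_ring
  · rw [star_mul, hTs]
    calc q = 1 - (1 - q) := by abel
      _ = ↑T⁻¹ * (t * (1 - (1 - q)) * t) * ↑T⁻¹ := by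
        rw [← mul_assoc, ← mul_assoc, hTr, one_mul, mul_assoc, hTl, mul_one]
      _ = ↑T⁻¹ * (t * t - t * ((1 - q) * t)) * ↑T⁻¹ := by noncomm_ring
      _ = ↑T⁻¹ * (star y * y) * ↑T⁻¹ := by
        rw [hqt, htq, htt, hz, add_sub_cancel_right]
      _ = ↑T⁻¹ * star y * (y * ↑T⁻¹) := by simp only [mul_assoc]

end CStar

/-! ### The C*-norm of matrix algebras -/

section MatrixNorm

variable {A : Type u} [CStarAlgebra A] {n : ℕ}

variable (A n) in
/-- The matrix algebra with its C*-norm, as an abstract C*-algebra. -/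
theorem exists_cstarAlgebra_matrix : ∃ (B : Type u) (_ : CStarAlgebra B)
    (f : Matrix (Fin n) (Fin n) A ≃⋆ₐ[ℂ] B), ∀ x, cstarMatrixNorm x = ‖f x‖ := by
  let _ := CStarAlgebra.spectralOrder A
  let _ := CStarAlgebra.spectralOrderedRing A
  exact ⟨CStarMatrix (Fin n) (Fin n) A, inferInstance, CStarMatrix.ofMatrixStarAlgEquiv,
    fun _ => rfl⟩

theorem norm_entry_le_cstarMatrixNorm (x : Matrix (Fin n) (Fin n) A) (r s : Fin n) :
    ‖x r s‖ ≤ cstarMatrixNorm x := by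
  let _ := CStarAlgebra.spectralOrder A
  let _ := CStarAlgebra.spectralOrderedRing A
  exact CStarMatrix.norm_entry_le_norm (M := CStarMatrix.ofMatrix x)

theorem cstarMatrixNorm_nonneg (x : Matrix (Fin n) (Fin n) A) : 0 ≤ cstarMatrixNorm x := by
  obtain ⟨B, _, f, hf⟩ := exists_cstarAlgebra_matrix A n
  rw [hf]
  exact norm_nonneg _

theorem cstarMatrixNorm_zero : cstarMatrixNorm (0 : Matrix (Fin n) (Fin n) A) = 0 := by
  obtain ⟨B, _, f, hf⟩ := exists_cstarAlgebra_matrix A n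
  rw [hf, map_zero, norm_zero]

theorem cstarMatrixNorm_add_le (x y : Matrix (Fin n) (Fin n) A) :
    cstarMatrixNorm (x + y) ≤ cstarMatrixNorm x + cstarMatrixNorm y := by
  obtain ⟨B, _, f, hf⟩ := exists_cstarAlgebra_matrix A n
  rw [hf, hf, hf, map_add]
  exact norm_add_le _ _

theorem cstarMatrixNorm_sub_le (x y z : Matrix (Fin n) (Fin n) A) :
    cstarMatrixNorm (x - z) ≤ cstarMatrixNorm (x - y) + cstarMatrixNorm (y - z) := by
  rw [← sub_add_sub_cancel x y z]
  exact cstarMatrixNorm_add_le _ _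

theorem cstarMatrixNorm_sub_comm (x y : Matrix (Fin n) (Fin n) A) :
    cstarMatrixNorm (x - y) = cstarMatrixNorm (y - x) := by
  obtain ⟨B, _, f, hf⟩ := exists_cstarAlgebra_matrix A n
  rw [hf, hf, map_sub, map_sub, norm_sub_rev]

theorem cstarMatrixNorm_sum_le {ι : Type*} (s : Finset ι) (x : ι → Matrix (Fin n) (Fin n) A) :
    cstarMatrixNorm (∑ i ∈ s, x i) ≤ ∑ i ∈ s, cstarMatrixNorm (x i) := by
  obtain ⟨B, _, f, hf⟩ := exists_cstarAlgebra_matrix A n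
  simp only [hf, map_sum]
  exact norm_sum_le _ _

/-- `a ↦ a ⊗ e_rr` as a `*`-homomorphism. -/
def cornerHom (r : Fin n) : A →⋆ₙₐ[ℂ] Matrix (Fin n) (Fin n) A where
  toFun := Matrix.single r r
  map_smul' c x := by simp
  map_zero' := by simp
  map_add' x y := by simp [Matrix.single_add]
  map_mul' x y := by simp
  map_star' x := by simp [star_eq_conjTranspose]

theorem cstarMatrixNorm_single_le (r s : Fin n) (a : A) :
    cstarMatrixNorm (Matrix.single r s a) ≤ ‖a‖ := by
  obtain ⟨B, _, f, hf⟩ := exists_cstarAlgebra_matrix A n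
  have h1 : star (Matrix.single r s a) * Matrix.single r s a = cornerHom s (star a * a) := by
    change _ = Matrix.single s s (star a * a)
    rw [star_eq_conjTranspose, conjTranspose_single, Matrix.single_mul_single_same]
  have h2 : ‖f (Matrix.single r s a)‖ * ‖f (Matrix.single r s a)‖ ≤ ‖a‖ * ‖a‖ := by
    rw [← CStarRing.norm_star_mul_self, ← CStarRing.norm_star_mul_self, ← map_star, ← map_mul, h1]
    let g : A →⋆ₙₐ[ℂ] B :=
      (f : Matrix (Fin n) (Fin n) A →⋆ₙₐ[ℂ] B).comp (cornerHom s)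
    exact NonUnitalStarAlgHom.norm_apply_le g _
  rw [hf]
  exact abs_le_of_sq_le_sq' (by rw [sq, sq]; exact h2) (norm_nonneg _) |>.2

theorem cstarMatrixNorm_le_sum (x : Matrix (Fin n) (Fin n) A) :
    cstarMatrixNorm x ≤ ∑ r, ∑ s, ‖x r s‖ := by
  conv_lhs => rw [Matrix.matrix_eq_sum_single x]
  refine (cstarMatrixNorm_sum_le _ _).trans (Finset.sum_le_sum fun r _ => ?_)
  exact (cstarMatrixNorm_sum_le _ _).trans
    (Finset.sum_le_sum fun s _ => cstarMatrixNorm_single_le _ _ _)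

theorem cstarMatrixNorm_lt_of_entries {x : Matrix (Fin n) (Fin n) A} {ε : ℝ} (hε : 0 < ε)
    (h : ∀ r s, ‖x r s‖ * (n * n) < ε) : cstarMatrixNorm x < ε := by
  refine (cstarMatrixNorm_le_sum x).trans_lt ?_
  rcases Nat.eq_zero_or_pos n with rfl | hn
  · simpa using hε
  have hn' : (0 : ℝ) < n := by exact_mod_cast hn
  have h' : ∀ r s, ‖x r s‖ < ε / (n * n) := fun r s => (lt_div_iff₀ (by positivity)).2 (h r s)
  have : Nonempty (Fin n) := ⟨⟨0, hn⟩⟩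
  calc _ < ∑ r : Fin n, ∑ s : Fin n, ε / (n * n) :=
        Finset.sum_lt_sum_of_nonempty Finset.univ_nonempty fun r _ =>
          Finset.sum_lt_sum_of_nonempty Finset.univ_nonempty fun s _ => h' r s
    _ = ε := by simp; field_simp

theorem exists_isStarProjection_of_newton_matrix {h : ℕ → Matrix (Fin n) (Fin n) A}
    (h0 : IsSelfAdjoint (h 0)) (hd : cstarMatrixNorm (h 0 * h 0 - h 0) ≤ 1 / 32)
    (hs : ∀ j, h (j + 1) = (3 : ℂ) • (h j * h j) - (2 : ℂ) • (h j * h j * h j)) :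
    ∃ p, IsStarProjection p ∧ ∀ j, cstarMatrixNorm (p - h j) ≤ 1 / 8 / 2 ^ j := by
  obtain ⟨B, _, f, hf⟩ := exists_cstarAlgebra_matrix A n
  obtain ⟨p, hp, hp'⟩ := exists_isStarProjection_of_newton (h := fun j => f (h j))
    (h0.map f) (by rwa [hf, map_sub, map_mul] at hd) (fun j => by
      rw [hs, map_sub, map_smul, map_smul, map_mul, map_mul, map_mul])
  refine ⟨f.symm p, ⟨?_, ?_⟩, fun j => ?_⟩
  · exact hp.isIdempotentElem.map f.symm
  · exact hp.isSelfAdjoint.map f.symm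
  · rw [hf, map_sub, StarAlgEquiv.apply_symm_apply]
    exact hp' j

theorem mvnEquiv_of_almost {p q x : Matrix (Fin n) (Fin n) A} (hp : IsStarProjection p)
    (hq : IsStarProjection q) (hxp : cstarMatrixNorm (x * star x - p) ≤ 1 / 4)
    (hxq : cstarMatrixNorm (star x * x - q) ≤ 1 / 4) : MvNEquiv p q := by
  obtain ⟨B, _, f, hf⟩ := exists_cstarAlgebra_matrix A n
  rw [hf, map_sub, map_mul, map_star] at hxp hxq
  obtain ⟨v, hv, hv'⟩ := exists_partialIsometry_of_almost (p := f p) (q := f q)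
    ⟨hp.isIdempotentElem.map f, hp.isSelfAdjoint.map f⟩
    ⟨hq.isIdempotentElem.map f, hq.isSelfAdjoint.map f⟩ hxp hxq
  refine ⟨f.symm v, EquivLike.injective f ?_, EquivLike.injective f ?_⟩
  · rw [← star_eq_conjTranspose, map_mul, map_star, StarAlgEquiv.apply_symm_apply, hv]
  · rw [← star_eq_conjTranspose, map_mul, map_star, StarAlgEquiv.apply_symm_apply, hv']

theorem mvnEquiv_of_close {p q : Matrix (Fin n) (Fin n) A} (hp : IsStarProjection p)
    (hq : IsStarProjection q) (h : cstarMatrixNorm (p - q) ≤ 1 / 4) : MvNEquiv p q := by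
  refine mvnEquiv_of_almost (x := p) hp hq ?_ ?_
  · rw [hp.isSelfAdjoint.star_eq, hp.isIdempotentElem.eq, sub_self, cstarMatrixNorm_zero]
    norm_num
  · rwa [hp.isSelfAdjoint.star_eq, hp.isIdempotentElem.eq]

/-- Continuity of `x ↦ F x` in the C*-norm for a map `F` that corresponds to a continuous map of the
abstract C*-algebra. -/
theorem exists_delta_of_continuous {F : Matrix (Fin n) (Fin n) A → Matrix (Fin n) (Fin n) A}
    (hF : ∀ (B : Type u) [CStarAlgebra B] (f : Matrix (Fin n) (Fin n) A ≃⋆ₐ[ℂ] B),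
      Continuous fun b => f (F (f.symm b))) (v : Matrix (Fin n) (Fin n) A) {ε : ℝ} (hε : 0 < ε) :
    ∃ δ > 0, ∀ x, cstarMatrixNorm (x - v) < δ → cstarMatrixNorm (F x - F v) < ε := by
  obtain ⟨B, _, f, hf⟩ := exists_cstarAlgebra_matrix A n
  obtain ⟨δ, hδ, h⟩ := Metric.continuous_iff.1 (hF B f) (f v) ε hε
  refine ⟨δ, hδ, fun x hx => ?_⟩
  have := h (f x) (by rwa [dist_eq_norm, ← map_sub, ← hf])
  rwa [dist_eq_norm, f.symm_apply_apply, f.symm_apply_apply, ← map_sub, ← hf] at this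

theorem exists_delta_mul_star (v : Matrix (Fin n) (Fin n) A) {ε : ℝ} (hε : 0 < ε) :
    ∃ δ > 0, ∀ x, cstarMatrixNorm (x - v) < δ →
      cstarMatrixNorm (x * star x - v * star v) < ε ∧
      cstarMatrixNorm (star x * x - star v * v) < ε := by
  obtain ⟨δ, hδ, h⟩ := exists_delta_of_continuous (F := fun x => x * star x) (fun B _ f => by
    simp only [map_mul, map_star, f.apply_symm_apply]
    fun_prop) v hε
  obtain ⟨δ', hδ', h'⟩ := exists_delta_of_continuous (F := fun x => star x * x) (fun B _ f => by
    simp only [map_mul, map_star, f.apply_symm_apply]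
    fun_prop) v hε
  exact ⟨min δ δ', lt_min hδ hδ', fun x hx =>
    ⟨h x (hx.trans_le (min_le_left _ _)), h' x (hx.trans_le (min_le_right _ _))⟩⟩

theorem cstarMatrixNorm_map_le {C : Type u} [CStarAlgebra C] (ψ : A →⋆ₙₐ[ℂ] C)
    (x : Matrix (Fin n) (Fin n) A) : cstarMatrixNorm (x.map ψ) ≤ cstarMatrixNorm x := by
  obtain ⟨B, _, f, hf⟩ := exists_cstarAlgebra_matrix A n
  obtain ⟨D, _, g, hg⟩ := exists_cstarAlgebra_matrix C n
  let Ψ : Matrix (Fin n) (Fin n) A →⋆ₙₐ[ℂ] Matrix (Fin n) (Fin n) C :=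
    { toFun := fun x => x.map ψ
      map_smul' := fun c x => by ext; simp
      map_zero' := by ext; simp
      map_add' := fun x y => by ext; simp
      map_mul' := fun x y => Matrix.map_mul
      map_star' := fun x => (map_conjTranspose' ψ x).symm }
  let k : B →⋆ₙₐ[ℂ] D := ((g : Matrix (Fin n) (Fin n) C →⋆ₙₐ[ℂ] D).comp Ψ).comp
    (f.symm : B →⋆ₙₐ[ℂ] Matrix (Fin n) (Fin n) A)
  have h := NonUnitalStarAlgHom.norm_apply_le k (f x)
  have e : k (f x) = g (x.map ψ) := by
    change g ((f.symm (f x)).map ψ) = _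
    rw [f.symm_apply_apply]
  rwa [e, ← hf, ← hg] at h

/-- The block-diagonal matrix with blocks `x` and `y`. -/
def blockDiag {m n : ℕ} (x : Matrix (Fin m) (Fin m) A) (y : Matrix (Fin n) (Fin n) A) :
    Matrix (Fin (m + n)) (Fin (m + n)) A :=
  (Matrix.fromBlocks x 0 0 y).submatrix finSumFinEquiv.symm finSumFinEquiv.symm

variable (A) in
/-- `(x, y) ↦ x ⊕ y` as a `*`-homomorphism from the product algebra. -/
def blockDiagHom (m n : ℕ) : Matrix (Fin m) (Fin m) A × Matrix (Fin n) (Fin n) A →⋆ₙₐ[ℂ]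
    Matrix (Fin (m + n)) (Fin (m + n)) A where
  toFun z := blockDiag z.1 z.2
  map_smul' c z := by
    ext i j
    rcases h : finSumFinEquiv.symm i with i' | i' <;> rcases h' : finSumFinEquiv.symm j with j' | j' <;>
      simp [blockDiag, h, h']
  map_zero' := by simp [blockDiag]
  map_add' z w := by
    ext i j
    rcases h : finSumFinEquiv.symm i with i' | i' <;> rcases h' : finSumFinEquiv.symm j with j' | j' <;>
      simp [blockDiag, h, h']
  map_mul' z w := by
    simp [blockDiag, Matrix.submatrix_mul_equiv, fromBlocks_multiply]
  map_star' z := by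
    simp [blockDiag, star_eq_conjTranspose, conjTranspose_submatrix, fromBlocks_conjTranspose]

theorem cstarMatrixNorm_blockDiag_le {m n : ℕ} (x : Matrix (Fin m) (Fin m) A)
    (y : Matrix (Fin n) (Fin n) A) :
    cstarMatrixNorm (blockDiag x y) ≤ max (cstarMatrixNorm x) (cstarMatrixNorm y) := by
  obtain ⟨B, _, f, hf⟩ := exists_cstarAlgebra_matrix A m
  obtain ⟨C, _, g, hg⟩ := exists_cstarAlgebra_matrix A n
  obtain ⟨D, _, h, hh⟩ := exists_cstarAlgebra_matrix A (m + n)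
  let fg : B × C →⋆ₙₐ[ℂ] Matrix (Fin m) (Fin m) A × Matrix (Fin n) (Fin n) A :=
    ((f.symm : B →⋆ₙₐ[ℂ] _).comp (NonUnitalStarAlgHom.fst ℂ B C)).prod
      ((g.symm : C →⋆ₙₐ[ℂ] _).comp (NonUnitalStarAlgHom.snd ℂ B C))
  let k : B × C →⋆ₙₐ[ℂ] D := ((h : _ →⋆ₙₐ[ℂ] D).comp (blockDiagHom A m n)).comp fg
  have hk := NonUnitalStarAlgHom.norm_apply_le k (f x, g y)
  have e : k (f x, g y) = h (blockDiag x y) := by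
    change h (blockDiag (f.symm (f x)) (g.symm (g y))) = _
    rw [f.symm_apply_apply, g.symm_apply_apply]
  rwa [e, Prod.norm_def, ← hf, ← hg, ← hh] at hk

theorem blockDiag_sub {m n : ℕ} (x x' : Matrix (Fin m) (Fin m) A)
    (y y' : Matrix (Fin n) (Fin n) A) :
    blockDiag x y - blockDiag x' y' = blockDiag (x - x') (y - y') :=
  (map_sub (blockDiagHom A m n) (x, y) (x', y')).symm

end MatrixNorm

/-! ### Rational points of matrix algebras -/

namespace Letter

/-- The row of the single nonzero entry of a letter over `n × n` matrices. -/
def row (n : ℕ) (l : Letter) : ℕ :=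
  bif l.2 then l.1.unpair.2.unpair.2 % n else l.1.unpair.2.unpair.1 % n

/-- The column of the single nonzero entry of a letter over `n × n` matrices. -/
def col (n : ℕ) (l : Letter) : ℕ :=
  bif l.2 then l.1.unpair.2.unpair.1 % n else l.1.unpair.2.unpair.2 % n

theorem row_lt (l : Letter) {n : ℕ} (hn : 0 < n) : l.row n < n := by
  rw [row]
  cases l.2 <;> exact Nat.mod_lt _ hn

theorem col_lt (l : Letter) {n : ℕ} (hn : 0 < n) : l.col n < n := by
  rw [col]
  cases l.2 <;> exact Nat.mod_lt _ hn

/-- The single nonzero entry of a letter over matrices, as a letter over the algebra. -/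
def base (l : Letter) : Letter := (l.1.unpair.1, l.2)

/-- The letter over matrices with the entry `l` in row `r` and column `s`. -/
def cell (r s : ℕ) (l : Letter) : Letter :=
  (Nat.pair l.1 (bif l.2 then Nat.pair s r else Nat.pair r s), l.2)

/-- The letter over larger matrices with the entry of `l` moved by `d` along the diagonal. -/
def shift (n d : ℕ) (l : Letter) : Letter :=
  (Nat.pair l.1.unpair.1
    (Nat.pair (l.1.unpair.2.unpair.1 % n + d) (l.1.unpair.2.unpair.2 % n + d)), l.2)

/-- The column of the only nonzero entry of a word over matrices, if there is one. -/
def lastCol (n : ℕ) (l : Letter) (w : List Letter) : Option ℕ :=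
  w.foldl (fun o m => o.bind fun c => bif decide (c = row n m) then some (col n m) else none)
    (some (col n l))

theorem lastCol_concat (n : ℕ) (l m : Letter) (w : List Letter) :
    lastCol n l (w ++ [m]) = (lastCol n l w).bind fun c =>
      bif decide (c = row n m) then some (col n m) else none := by
  simp [lastCol]

end Letter

namespace StarPoly

/-- The entry in row `r` and column `s` of a `*`-polynomial over `n × n` matrices. -/
def entry (n r s : ℕ) (p : StarPoly) : StarPoly :=
  p.flatMap fun t =>
    bif decide (Letter.row n t.2.1 = r) && decide (Letter.lastCol n t.2.1 t.2.2 = some s) then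
      [(t.1, t.2.1.base, t.2.2.map Letter.base)] else []

/-- The matrix with entries `p r s`, as a `*`-polynomial over matrices. -/
def ofEntries (n : ℕ) (p : ℕ → ℕ → StarPoly) : StarPoly :=
  (List.range n).flatMap fun r => (List.range n).flatMap fun s =>
    subst (Letter.cell r s) (Letter.cell s s) (p r s)

/-- The block-diagonal sum of `*`-polynomials over `m × m` and `n × n` matrices. -/
def blockSum (m n : ℕ) (p q : StarPoly) : StarPoly :=
  subst (Letter.shift m 0) (Letter.shift m 0) p ++ subst (Letter.shift n m) (Letter.shift n m) q

end StarPoly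

section Eval

variable {A : Type u} [CStarAlgebra A] {n : ℕ}

theorem evalLetter_matrixPoint (a : ℕ → A) (l : Letter) (r s : Fin n) :
    evalLetter (matrixPoint a n) l r s =
      if (r : ℕ) = l.row n ∧ (s : ℕ) = l.col n then evalLetter a l.base else 0 := by
  obtain ⟨k, b⟩ := l
  cases b
  · simp [evalLetter, matrixPoint, Letter.row, Letter.col, Letter.base]
  · simp only [evalLetter, matrixPoint, Letter.row, Letter.col, Letter.base, if_true, cond_true,
      star_eq_conjTranspose, conjTranspose_apply, and_comm]
    split_ifs <;> simp

theorem evalWord_matrixPoint (a : ℕ → A) (l : Letter) (w : List Letter) (r s : Fin n) :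
    evalWord (matrixPoint a n) l w r s =
      if l.row n = r ∧ Letter.lastCol n l w = some (s : ℕ) then
        evalWord a l.base (w.map Letter.base) else 0 := by
  induction w using List.reverseRecOn generalizing s with
  | nil =>
    have h := evalLetter_matrixPoint a l r s
    simp only [eq_comm (a := (r : ℕ)), eq_comm (a := (s : ℕ))] at h
    simpa [evalWord, Letter.lastCol] using h
  | append_singleton w m ih =>
    have hn : 0 < n := r.pos
    have hm := m.row_lt hn
    rw [StarPoly.evalWord_concat, Matrix.mul_apply, List.map_append, List.map_cons, List.map_nil,
      StarPoly.evalWord_concat, Letter.lastCol_concat, Finset.sum_eq_single ⟨m.row n, hm⟩]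
    · rw [ih, evalLetter_matrixPoint]
      cases h : Letter.lastCol n l w with
      | none => simp
      | some c =>
        by_cases h1 : l.row n = r <;> by_cases h2 : c = m.row n <;>
          by_cases h3 : (s : ℕ) = m.col n <;> simp [h1, h2, h3, eq_comm]
    · intro k _ hk
      rw [evalLetter_matrixPoint, if_neg, mul_zero]
      rintro ⟨h, -⟩
      exact hk (Fin.ext h)
    · simp

namespace StarPoly

theorem eval_matrixPoint_apply (a : ℕ → A) (p : StarPoly) (r s : Fin n) :
    p.eval (matrixPoint a n) r s = (entry n r s p).eval a := by
  induction p with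
  | nil => simp [entry, eval_nil]
  | cons t p ih =>
    have : entry n r s (t :: p) = (bif decide (Letter.row n t.2.1 = r) &&
        decide (Letter.lastCol n t.2.1 t.2.2 = some (s : ℕ)) then
      [(t.1, t.2.1.base, t.2.2.map Letter.base)] else []) ++ entry n r s p := rfl
    rw [this, eval_cons, eval_append, ← ih, Matrix.add_apply, Matrix.smul_apply,
      evalWord_matrixPoint]
    congr 1
    by_cases h1 : Letter.row n t.2.1 = r <;>
      by_cases h2 : Letter.lastCol n t.2.1 t.2.2 = some (s : ℕ) <;>
      simp [h1, h2, eval_cons, eval_nil]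

theorem eval_cell (a : ℕ → A) (p : StarPoly) (r s : Fin n) :
    (subst (Letter.cell r s) (Letter.cell s s) p).eval (matrixPoint a n) =
      Matrix.single r s (p.eval a) := by
  have hcell : ∀ (r s : Fin n) l,
      evalLetter (matrixPoint a n) (Letter.cell r s l) = Matrix.single r s (evalLetter a l) := by
    intro r s l
    ext i j
    rw [evalLetter_matrixPoint]
    have h1 : (Letter.cell r s l).row n = r := by
      obtain ⟨k, b⟩ := l
      cases b <;> simp [Letter.row, Letter.cell, Nat.mod_eq_of_lt r.2]
    have h2 : (Letter.cell r s l).col n = s := by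
      obtain ⟨k, b⟩ := l
      cases b <;> simp [Letter.col, Letter.cell, Nat.mod_eq_of_lt s.2]
    have h3 : (Letter.cell r s l).base = l := by
      simp [Letter.base, Letter.cell]
    rw [h1, h2, h3, Matrix.single_apply]
    congr 1
    simp [Fin.ext_iff, eq_comm]
  refine eval_subst (a := a) (Matrix.singleLinearMap ℂ r s) (fun l => hcell r s l) (fun x l => ?_) p
  change Matrix.single r s x * _ = Matrix.single r s _
  rw [hcell, Matrix.single_mul_single_same]

theorem eval_ofEntries (a : ℕ → A) (p : ℕ → ℕ → StarPoly) :
    (ofEntries n p).eval (matrixPoint a n) = Matrix.of fun r s : Fin n => (p r s).eval a := by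
  have key : ∀ g : ℕ → Matrix (Fin n) (Fin n) A, ((List.range n).map g).sum = ∑ i : Fin n, g i :=
    fun g => (show _ = ∑ i ∈ Finset.range n, g i from rfl).trans (Finset.sum_range g)
  rw [ofEntries, eval_flatMap, key]
  simp only [eval_flatMap, key]
  simp only [eval_cell]
  exact (Matrix.matrix_eq_sum_single _).symm

theorem eval_blockSum {m : ℕ} (hm : 0 < m) (hn : 0 < n) (a : ℕ → A) (p q : StarPoly) :
    (blockSum m n p q).eval (matrixPoint a (m + n)) =
      blockDiag (p.eval (matrixPoint a m)) (q.eval (matrixPoint a n)) := by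
  have h1 : (subst (Letter.shift m 0) (Letter.shift m 0) p).eval (matrixPoint a (m + n)) =
      blockDiag (p.eval (matrixPoint a m)) 0 := by
    let φ : Matrix (Fin m) (Fin m) A →ₗ[ℂ] Matrix (Fin (m + n)) (Fin (m + n)) A :=
      (LinearMapClass.linearMap (blockDiagHom A m n)) ∘ₗ LinearMap.inl ℂ _ _
    have hl : ∀ l, evalLetter (matrixPoint a (m + n)) (l.shift m 0) =
        φ (evalLetter (matrixPoint a m) l) := by
      intro l
      ext i j
      change _ = blockDiag (evalLetter (matrixPoint a m) l) 0 i j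
      have hmod : ∀ k, k % m % (m + n) = k % m := fun k =>
        Nat.mod_eq_of_lt ((Nat.mod_lt k hm).trans_le (Nat.le_add_right m n))
      have hrow : (l.shift m 0).row (m + n) = l.row m := by
        obtain ⟨k, b⟩ := l
        cases b <;> simp [Letter.row, Letter.shift, hmod]
      have hcol : (l.shift m 0).col (m + n) = l.col m := by
        obtain ⟨k, b⟩ := l
        cases b <;> simp [Letter.col, Letter.shift, hmod]
      have hrm := l.row_lt hm
      have hcm := l.col_lt hm
      have hbase : (l.shift m 0).base = l.base := by simp [Letter.base, Letter.shift]
      rw [evalLetter_matrixPoint, hrow, hcol, hbase]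
      refine Fin.addCases (fun i => ?_) (fun i => ?_) i <;>
        refine Fin.addCases (fun j => ?_) (fun j => ?_) j <;>
        simp [blockDiag, evalLetter_matrixPoint] <;> omega
    refine eval_subst φ hl (fun x l => ?_) p
    rw [hl]
    change blockDiagHom A m n (x, 0) * blockDiagHom A m n (_, 0) = blockDiagHom A m n (_, 0)
    rw [← map_mul, Prod.mk_mul_mk, mul_zero]
    rfl
  have h2 : (subst (Letter.shift n m) (Letter.shift n m) q).eval (matrixPoint a (m + n)) =
      blockDiag 0 (q.eval (matrixPoint a n)) := by
    let φ : Matrix (Fin n) (Fin n) A →ₗ[ℂ] Matrix (Fin (m + n)) (Fin (m + n)) A :=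
      (LinearMapClass.linearMap (blockDiagHom A m n)) ∘ₗ LinearMap.inr ℂ _ _
    have hl : ∀ l, evalLetter (matrixPoint a (m + n)) (l.shift n m) =
        φ (evalLetter (matrixPoint a n) l) := by
      intro l
      ext i j
      change _ = blockDiag 0 (evalLetter (matrixPoint a n) l) i j
      have hmod : ∀ k, (k % n + m) % (m + n) = k % n + m := fun k =>
        Nat.mod_eq_of_lt (by have := Nat.mod_lt k hn; omega)
      have hrow : (l.shift n m).row (m + n) = l.row n + m := by
        obtain ⟨k, b⟩ := l
        cases b <;> simp [Letter.row, Letter.shift, hmod]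
      have hcol : (l.shift n m).col (m + n) = l.col n + m := by
        obtain ⟨k, b⟩ := l
        cases b <;> simp [Letter.col, Letter.shift, hmod]
      have hbase : (l.shift n m).base = l.base := by simp [Letter.base, Letter.shift]
      rw [evalLetter_matrixPoint, hrow, hcol, hbase]
      refine Fin.addCases (fun i => ?_) (fun i => ?_) i <;>
        refine Fin.addCases (fun j => ?_) (fun j => ?_) j <;>
        simp [blockDiag, evalLetter_matrixPoint, add_comm m] <;> omega
    refine eval_subst φ hl (fun x l => ?_) q
    rw [hl]
    change blockDiagHom A m n (0, x) * blockDiagHom A m n (0, _) = blockDiagHom A m n (0, _)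
    rw [← map_mul, Prod.mk_mul_mk, mul_zero]
    rfl
  rw [blockSum, eval_append, h1, h2]
  change blockDiagHom A m n (_, 0) + blockDiagHom A m n (0, _) = blockDiagHom A m n (_, _)
  rw [← map_add, Prod.mk_add_mk, add_zero, zero_add]

end StarPoly

/-! ### Density of the rational points -/

theorem exists_coeffVal_near (c : ℂ) {ε : ℝ} (hε : 0 < ε) : ∃ t, ‖coeffVal t - c‖ < ε := by
  obtain ⟨x, hx⟩ := exists_rat_btwn (show c.re < c.re + ε / 2 by linarith)
  obtain ⟨y, hy⟩ := exists_rat_btwn (show c.im < c.im + ε / 2 by linarith)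
  obtain ⟨s, rfl⟩ := RatCode.exists_val_eq x
  obtain ⟨t, rfl⟩ := RatCode.exists_val_eq y
  refine ⟨(s, t), (Complex.norm_le_abs_re_add_abs_im _).trans_lt ?_⟩
  simp only [coeffVal, Complex.sub_re, Complex.sub_im]
  rw [abs_of_pos (by linarith), abs_of_pos (by linarith)]
  linarith

/-- The `*`-polynomials with coefficients in `ℚ(i)` are dense: their closure is a `*`-subalgebra. -/
theorem CStarPresentation.dense_eval (P : CStarPresentation A) :
    Dense (Set.range fun p : StarPoly => p.eval P.point) := by
  refine P.dense_adjoin.mono ?_ |>.of_closure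
  intro x hx
  induction hx using NonUnitalStarAlgebra.adjoin_induction with
  | mem x hx =>
    obtain ⟨i, rfl⟩ := hx
    refine subset_closure ⟨[(((1, 0, 0), (0, 0, 0)), (i, false), [])], ?_⟩
    have := StarPoly.coeffVal_natCast 1
    simp [StarPoly.eval_cons, StarPoly.eval_nil, evalWord, evalLetter, this]
  | add x y _ _ hx hy =>
    refine map_mem_closure₂ continuous_add hx hy ?_
    rintro _ ⟨p, rfl⟩ _ ⟨q, rfl⟩
    exact ⟨p ++ q, StarPoly.eval_append _ _ _⟩
  | zero => exact subset_closure ⟨[], StarPoly.eval_nil _⟩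
  | mul x y _ _ hx hy =>
    refine map_mem_closure₂ continuous_mul hx hy ?_
    rintro _ ⟨p, rfl⟩ _ ⟨q, rfl⟩
    exact ⟨p.mul q, StarPoly.eval_mul _ _ _⟩
  | smul c x _ hx =>
    have hc : c ∈ closure (Set.range coeffVal) := by
      refine Metric.mem_closure_iff.2 fun ε hε => ?_
      obtain ⟨t, ht⟩ := exists_coeffVal_near c hε
      exact ⟨_, ⟨t, rfl⟩, by rwa [dist_comm, dist_eq_norm]⟩
    refine map_mem_closure₂ (f := fun (c : ℂ) (x : A) => c • x) continuous_smul hc hx ?_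
    rintro _ ⟨c, rfl⟩ _ ⟨p, rfl⟩
    exact ⟨p.scale c, StarPoly.eval_scale _ _ _⟩
  | star x _ hx =>
    refine map_mem_closure continuous_star hx ?_
    rintro _ ⟨p, rfl⟩
    exact ⟨p.conj, StarPoly.eval_conj _ _⟩

theorem CStarPresentation.exists_eval_matrix_near (P : CStarPresentation A)
    (x : Matrix (Fin n) (Fin n) A) {ε : ℝ} (hε : 0 < ε) :
    ∃ p : StarPoly, cstarMatrixNorm (p.eval (matrixPoint P.point n) - x) < ε := by
  have hδ : 0 < ε / (n * n + 1) := by positivity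
  have h : ∀ r s : Fin n, ∃ p : StarPoly, ‖p.eval P.point - x r s‖ < ε / (n * n + 1) := by
    intro r s
    obtain ⟨_, ⟨p, rfl⟩, hp⟩ := Metric.mem_closure_iff.1 (P.dense_eval (x r s)) _ hδ
    exact ⟨p, by rwa [← dist_eq_norm, dist_comm]⟩
  choose p hp using h
  refine ⟨StarPoly.ofEntries n fun r s =>
    if h : r < n ∧ s < n then p ⟨r, h.1⟩ ⟨s, h.2⟩ else [], ?_⟩
  refine cstarMatrixNorm_lt_of_entries hε fun r s => ?_
  rw [StarPoly.eval_ofEntries, Matrix.sub_apply, Matrix.of_apply, dif_pos ⟨r.2, s.2⟩]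
  have h1 := (lt_div_iff₀ (by positivity)).1 (hp r s)
  refine lt_of_le_of_lt ?_ h1
  exact mul_le_mul_of_nonneg_left (by linarith) (norm_nonneg _)

end Eval

/-! ### Primitive recursiveness of the operations on matrices -/

section PrimrecMatrix

variable {α : Type} [Primcodable α]

@[fun_prop]
theorem primrec_row {n : α → ℕ} {l : α → Letter} (hn : Primrec n) (hl : Primrec l) :
    Primrec fun a => (l a).row (n a) := by
  unfold Letter.row
  fun_prop

@[fun_prop]
theorem primrec_col {n : α → ℕ} {l : α → Letter} (hn : Primrec n) (hl : Primrec l) :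
    Primrec fun a => (l a).col (n a) := by
  unfold Letter.col
  fun_prop

@[fun_prop]
theorem primrec_base {l : α → Letter} (hl : Primrec l) : Primrec fun a => (l a).base := by
  unfold Letter.base
  fun_prop

@[fun_prop]
theorem primrec_cell {r s : α → ℕ} {l : α → Letter} (hr : Primrec r) (hs : Primrec s)
    (hl : Primrec l) : Primrec fun a => (l a).cell (r a) (s a) := by
  unfold Letter.cell
  fun_prop

@[fun_prop]
theorem primrec_shift {n d : α → ℕ} {l : α → Letter} (hn : Primrec n) (hd : Primrec d)
    (hl : Primrec l) : Primrec fun a => (l a).shift (n a) (d a) := by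
  unfold Letter.shift
  fun_prop

@[fun_prop]
theorem primrec_entry {n r s : α → ℕ} {p : α → StarPoly} (hn : Primrec n) (hr : Primrec r)
    (hs : Primrec s) (hp : Primrec p) : Primrec fun a => (p a).entry (n a) (r a) (s a) := by
  unfold StarPoly.entry Letter.lastCol
  fun_prop

@[fun_prop]
theorem primrec_ofEntries {n : α → ℕ} {p : α → ℕ → ℕ → StarPoly} (hn : Primrec n)
    (hp : Primrec fun x : α × ℕ × ℕ => p x.1 x.2.1 x.2.2) :
    Primrec fun a => StarPoly.ofEntries (n a) (p a) := by
  unfold StarPoly.ofEntries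
  have h : Primrec fun x : (α × ℕ) × ℕ => p x.1.1 x.1.2 x.2 :=
    hp.comp (f := fun x : α × ℕ × ℕ => p x.1 x.2.1 x.2.2)
      (g := fun x : (α × ℕ) × ℕ => (x.1.1, x.1.2, x.2)) (by fun_prop)
  fun_prop

@[fun_prop]
theorem primrec_blockSum {m n : α → ℕ} {p q : α → StarPoly} (hm : Primrec m) (hn : Primrec n)
    (hp : Primrec p) (hq : Primrec q) :
    Primrec fun a => StarPoly.blockSum (m a) (n a) (p a) (q a) := by
  unfold StarPoly.blockSum
  fun_prop

end PrimrecMatrix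

/-! ### Certificates of norm bounds -/

/-- Within `k` steps, the `t`-th norm bounds that the algorithm `e` gives for the entries of `p` certify
that the `n × n` matrix `p` has norm less than `1 / K`. -/
def cert (e : Code) (n K : ℕ) (p : StarPoly) (t k : ℕ) : Bool :=
  (List.range n).all fun r => (List.range n).all fun s =>
    ((run k e (p.entry n r s, t) : Option RatCode).map fun v =>
      decide (v.1 * (K * (n * n)) < v.2.1 * (K * (n * n)) + (v.2.2 + 1))).getD false

@[fun_prop]
theorem primrec_cert {α : Type} [Primcodable α] {e : α → Code} {n K t k : α → ℕ}
    {p : α → StarPoly} (he : Primrec e) (hn : Primrec n) (hK : Primrec K) (hp : Primrec p)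
    (ht : Primrec t) (hk : Primrec k) :
    Primrec fun a => cert (e a) (n a) (K a) (p a) (t a) (k a) := by
  unfold cert
  fun_prop

theorem RatCode.val_mul_lt_one_iff (v : RatCode) (m : ℕ) :
    (v.val : ℝ) * m < 1 ↔ v.1 * m < v.2.1 * m + (v.2.2 + 1) := by
  have h : (0 : ℝ) < v.2.2 + 1 := by positivity
  rw [← Nat.cast_lt (α := ℝ), RatCode.val]
  push_cast
  rw [div_mul_eq_mul_div, div_lt_one h, sub_mul, sub_lt_iff_lt_add, add_comm]

section Cert

variable {A : Type u} [CStarAlgebra A] {P : CStarPresentation A} {e : Code}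

theorem cstarMatrixNorm_lt_of_cert (he : P.IsRightCEIndex e) {n K : ℕ} (hK : 0 < K)
    {p : StarPoly} {t k : ℕ} (h : cert e n K p t k) :
    cstarMatrixNorm (p.eval (matrixPoint P.point n)) < 1 / K := by
  have hK' : (0 : ℝ) < K := by exact_mod_cast hK
  refine cstarMatrixNorm_lt_of_entries (by positivity) fun r s => ?_
  rw [StarPoly.eval_matrixPoint_apply, lt_div_iff₀ hK']
  simp only [cert, List.all_eq_true, List.mem_range] at h
  have h1 := h r r.2 s s.2
  obtain ⟨v, hv, hanti, hlim⟩ := he (p.entry n r s)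
  cases hrun : (run k e (p.entry n r s, t) : Option RatCode) with
  | none => simp [hrun] at h1
  | some u =>
    obtain rfl := eq_of_run_eq_some (hv t) hrun
    simp only [hrun, Option.map_some, Option.getD_some, decide_eq_true_eq] at h1
    have h2 := (RatCode.val_mul_lt_one_iff _ _).2 h1
    have h3 : ‖(p.entry n r s).eval P.point‖ ≤ ((v t).val : ℝ) :=
      Antitone.le_of_tendsto (fun i j hij => by exact_mod_cast hanti hij) hlim t
    refine lt_of_le_of_lt ?_ h2
    push_cast
    calc _ = ‖(p.entry n r s).eval P.point‖ * (K * (n * n)) := by ring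
      _ ≤ _ := mul_le_mul_of_nonneg_right h3 (by positivity)

theorem exists_forall_cert (he : P.IsRightCEIndex e) {n K : ℕ} {p : StarPoly}
    (h : cstarMatrixNorm (p.eval (matrixPoint P.point n)) * (K * (n * n)) < 1) :
    ∀ᶠ t in atTop, ∀ᶠ k in atTop, cert e n K p t k = true := by
  choose v hv hanti hlim using he
  have h1 : ∀ r s : Fin n, ∀ᶠ t in atTop,
      ((v (p.entry n r s) t).val : ℝ) * (K * (n * n) : ℕ) < 1 := by
    intro r s
    refine ((hlim (p.entry n r s)).mul_const _).eventually_lt_const ?_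
    rw [← StarPoly.eval_matrixPoint_apply]
    push_cast
    exact (mul_le_mul_of_nonneg_right (norm_entry_le_cstarMatrixNorm _ r s)
      (by positivity)).trans_lt h
  filter_upwards [eventually_all.2 fun r => eventually_all.2 fun s => h1 r s] with t ht
  have h2 : ∀ r s : Fin n, ∀ᶠ k in atTop,
      (run k e (p.entry n r s, t) : Option RatCode) = some (v (p.entry n r s) t) := by
    intro r s
    obtain ⟨k, hk⟩ := exists_run_eq_some (hv (p.entry n r s) t)
    exact eventually_atTop.2 ⟨k, hk⟩
  filter_upwards [eventually_all.2 fun r => eventually_all.2 fun s => h2 r s] with k hk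
  simp only [cert, List.all_eq_true, List.mem_range]
  intro r hr s hs
  rw [hk ⟨r, hr⟩ ⟨s, hs⟩]
  simpa using (RatCode.val_mul_lt_one_iff _ _).1 (ht ⟨r, hr⟩ ⟨s, hs⟩)

end Cert

/-! ### Approximations of projections by rational points -/

/-- A size `n` with a `*`-polynomial over `n × n` matrices. -/
abbrev MatPoly : Type := ℕ × StarPoly

/-- The block-diagonal sum of `*`-polynomials over matrices, with the sum of the sizes. -/
def MatPoly.sum (y z : MatPoly) : MatPoly := (y.1 + z.1, StarPoly.blockSum y.1 z.1 y.2 z.2)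

@[fun_prop]
theorem primrec_matPolySum {α : Type} [Primcodable α] {y z : α → MatPoly} (hy : Primrec y)
    (hz : Primrec z) : Primrec fun a => (y a).sum (z a) := by
  unfold MatPoly.sum
  fun_prop

section Approx

variable {A : Type u} [CStarAlgebra A] {P : CStarPresentation A}

/-- The rational point `y` is within `ε` of the projection `p`. Only positive sizes are admitted, since
the special points of matrix algebras are indexed through remainders modulo the size. -/
def Approx (P : CStarPresentation A) (p : Proj A) (y : MatPoly) (ε : ℝ) : Prop :=
  0 < y.1 ∧ y.1 = p.1 ∧ cstarMatrixNorm (p.2.1 - y.2.eval (matrixPoint P.point p.1)) ≤ ε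

theorem Approx.mono {p : Proj A} {y : MatPoly} {ε δ : ℝ} (h : Approx P p y ε) (hε : ε ≤ δ) :
    Approx P p y δ :=
  ⟨h.1, h.2.1, h.2.2.trans hε⟩

theorem Approx.sum {p q : Proj A} {y z : MatPoly} {ε : ℝ} (h : Approx P p y ε)
    (h' : Approx P q z ε) : Approx P (p.sum q) (y.sum z) ε := by
  obtain ⟨m, p⟩ := p
  obtain ⟨n, q⟩ := q
  obtain ⟨m', y⟩ := y
  obtain ⟨n', z⟩ := z
  obtain ⟨hm, rfl, hp⟩ := h
  obtain ⟨hn, rfl, hq⟩ := h'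
  refine ⟨Nat.add_pos_left hm _, rfl, ?_⟩
  change cstarMatrixNorm (blockDiag p.1 q.1 - (StarPoly.blockSum m' n' y z).eval
    (matrixPoint P.point (m' + n'))) ≤ ε
  rw [StarPoly.eval_blockSum hm hn, blockDiag_sub]
  exact (cstarMatrixNorm_blockDiag_le _ _).trans (max_le hp hq)

variable (A) in
/-- The zero projection in the algebra of `n × n` matrices. -/
abbrev zeroProj (n : ℕ) : Proj A := ⟨n, 0, .zero _⟩

theorem approx_zeroProj {n : ℕ} (hn : 0 < n) {ε : ℝ} (hε : 0 ≤ ε) :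
    Approx P (zeroProj A n) (n, []) ε := by
  refine ⟨hn, rfl, ?_⟩
  change cstarMatrixNorm (0 - StarPoly.eval [] (matrixPoint P.point n)) ≤ ε
  rw [StarPoly.eval_nil, sub_self, cstarMatrixNorm_zero]
  exact hε

theorem MvN.mk_eq_mk {p q : Proj A} : MvN.mk p = MvN.mk q ↔ MvNEquiv p.2.1 q.2.1 :=
  Quotient.eq (r := projSetoid A)

theorem MvN.mk_sum_zeroProj (p : Proj A) (n : ℕ) :
    MvN.mk (p.sum (zeroProj A n)) = MvN.mk p := by
  have hp : IsStarProjection p.2.1 := p.2.2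
  have h1 : (p.2.1)ᴴ = p.2.1 := hp.isSelfAdjoint
  have h2 : p.2.1 * p.2.1 = p.2.1 := hp.isIdempotentElem
  have h : MvNEquiv (Matrix.fromBlocks p.2.1 0 0 (0 : Matrix (Fin n) (Fin n) A)) p.2.1 := by
    refine ⟨Matrix.fromRows p.2.1 0, ?_, ?_⟩
    · rw [conjTranspose_fromRows_eq_fromCols_conjTranspose, fromRows_mul_fromCols, h1, h2]
      simp
    · rw [conjTranspose_fromRows_eq_fromCols_conjTranspose, fromCols_mul_fromRows, h1, h2]
      simp
  exact MvN.mk_eq_mk.2 (MvNEquiv.trans (p.sum _).2.2 p.2.2 (Proj.mvn_sum p _).symm h)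

theorem MvN.mk_zeroProj_sum (p : Proj A) (n : ℕ) :
    MvN.mk ((zeroProj A n).sum p) = MvN.mk p := by
  rw [← MvN.mk_add_mk, add_comm, MvN.mk_add_mk, MvN.mk_sum_zeroProj]

end Approx

/-! ### The test for Murray-von Neumann equivalence -/

/-- The `*`-polynomial `x` is certified to be an approximate partial isometry between `y ⊕ 0` and
`0 ⊕ z`. -/
def equivTest (e : Code) (y z : MatPoly) (x : StarPoly) (t k : ℕ) : Bool :=
  cert e (y.1 + z.1) 8 (.sub (.mul x (.conj x)) (y.sum (z.1, [])).2) t k &&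
    cert e (y.1 + z.1) 8 (.sub (.mul (.conj x) x) (MatPoly.sum (y.1, []) z).2) t k

@[fun_prop]
theorem primrec_equivTest {α : Type} [Primcodable α] {e : α → Code} {y z : α → MatPoly}
    {x : α → StarPoly} {t k : α → ℕ} (he : Primrec e) (hy : Primrec y) (hz : Primrec z)
    (hx : Primrec x) (ht : Primrec t) (hk : Primrec k) :
    Primrec fun a => equivTest (e a) (y a) (z a) (x a) (t a) (k a) := by
  unfold equivTest
  fun_prop

section Test

variable {A : Type u} [CStarAlgebra A] {P : CStarPresentation A} {e : Code}

theorem mk_eq_mk_of_equivTest (he : P.IsRightCEIndex e) {p q : Proj A} {y z : MatPoly}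
    (hp : Approx P p y (1 / 8)) (hq : Approx P q z (1 / 8)) {x : StarPoly} {t k : ℕ}
    (h : equivTest e y z x t k) : MvN.mk p = MvN.mk q := by
  have h1 := hp.sum (approx_zeroProj (A := A) (P := P) hq.1 (ε := 1 / 8) (by norm_num))
  have h2 := (approx_zeroProj (A := A) (P := P) hp.1 (ε := 1 / 8) (by norm_num)).sum hq
  obtain ⟨m, p⟩ := p
  obtain ⟨n, q⟩ := q
  obtain ⟨m', y⟩ := y
  obtain ⟨n', z⟩ := z
  obtain ⟨hm, rfl, -⟩ := hp
  obtain ⟨hn, rfl, -⟩ := hq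
  simp only at *
  rw [equivTest, Bool.and_eq_true] at h
  have h3 := cstarMatrixNorm_lt_of_cert he (by norm_num) h.1
  have h4 := cstarMatrixNorm_lt_of_cert he (by norm_num) h.2
  rw [StarPoly.eval_sub, StarPoly.eval_mul, StarPoly.eval_conj] at h3 h4
  rw [← MvN.mk_sum_zeroProj ⟨m', p⟩ n', ← MvN.mk_zeroProj_sum ⟨n', q⟩ m']
  refine MvN.mk_eq_mk.2 (mvnEquiv_of_almost (n := m' + n')
    (x := x.eval (matrixPoint P.point (m' + n'))) (Proj.sum _ _).2.2 (Proj.sum _ _).2.2 ?_ ?_)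
  · refine (cstarMatrixNorm_sub_le _ _ _).trans (add_le_add h3.le
      ((cstarMatrixNorm_sub_comm _ _).trans_le h1.2.2) |>.trans ?_)
    norm_num
  · refine (cstarMatrixNorm_sub_le _ _ _).trans (add_le_add h4.le
      ((cstarMatrixNorm_sub_comm _ _).trans_le h2.2.2) |>.trans ?_)
    norm_num

theorem exists_one_div_two_pow_lt {ε : ℝ} (hε : 0 < ε) : ∃ j : ℕ, 1 / 8 / 2 ^ j < ε := by
  obtain ⟨j, hj⟩ := exists_pow_lt_of_lt_one (show (0 : ℝ) < 8 * ε by positivity)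
    (show (2⁻¹ : ℝ) < 1 by norm_num)
  refine ⟨j, ?_⟩
  rw [inv_pow] at hj
  rw [div_div, one_div, mul_inv]
  linarith

theorem exists_equivTest_of_near (he : P.IsRightCEIndex e) {p q : Proj A} {y z : MatPoly} {η : ℝ}
    (hη : (η + η) * (8 * ((p.1 + q.1 : ℕ) * (p.1 + q.1 : ℕ))) < 1) (hp : Approx P p y η)
    (hq : Approx P q z η) {x : StarPoly}
    (h : cstarMatrixNorm (x.eval (matrixPoint P.point (p.1 + q.1)) *
      star (x.eval (matrixPoint P.point (p.1 + q.1))) -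
        blockDiag p.2.1 (0 : Matrix (Fin q.1) (Fin q.1) A)) < η)
    (h' : cstarMatrixNorm (star (x.eval (matrixPoint P.point (p.1 + q.1))) *
      x.eval (matrixPoint P.point (p.1 + q.1)) -
        blockDiag (0 : Matrix (Fin p.1) (Fin p.1) A) q.2.1) < η) :
    ∃ t k, equivTest e y z x t k := by
  have hη0 : 0 ≤ η := (cstarMatrixNorm_nonneg _).trans h.le
  have h1 := hp.sum (approx_zeroProj (A := A) (P := P) hq.1 hη0)
  have h2 := (approx_zeroProj (A := A) (P := P) hp.1 hη0).sum hq
  obtain ⟨m, p⟩ := p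
  obtain ⟨n, q⟩ := q
  obtain ⟨m', y⟩ := y
  obtain ⟨n', z⟩ := z
  obtain ⟨hm, rfl, -⟩ := hp
  obtain ⟨hn, rfl, -⟩ := hq
  have h3 : ∀ᶠ t in atTop, ∀ᶠ k in atTop, cert e (m' + n') 8
      (.sub (.mul x (.conj x)) (MatPoly.sum (m', y) (n', [])).2) t k = true := by
    refine exists_forall_cert he (lt_of_le_of_lt ?_ hη)
    rw [StarPoly.eval_sub, StarPoly.eval_mul, StarPoly.eval_conj]
    exact mul_le_mul_of_nonneg_right ((cstarMatrixNorm_sub_le _ _ _).trans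
      (add_le_add h.le h1.2.2)) (by positivity)
  have h4 : ∀ᶠ t in atTop, ∀ᶠ k in atTop, cert e (m' + n') 8
      (.sub (.mul (.conj x) x) (MatPoly.sum (m', []) (n', z)).2) t k = true := by
    refine exists_forall_cert he (lt_of_le_of_lt ?_ hη)
    rw [StarPoly.eval_sub, StarPoly.eval_mul, StarPoly.eval_conj]
    exact mul_le_mul_of_nonneg_right ((cstarMatrixNorm_sub_le _ _ _).trans
      (add_le_add h'.le h2.2.2)) (by positivity)
  obtain ⟨t, ht3, ht4⟩ := (h3.and h4).exists
  obtain ⟨k, hk3, hk4⟩ := (ht3.and ht4).exists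
  exact ⟨t, k, Bool.and_eq_true_iff.2 ⟨hk3, hk4⟩⟩

theorem exists_equivTest (he : P.IsRightCEIndex e) {p q : Proj A} {y z : ℕ → MatPoly}
    (hp : ∀ j, Approx P p (y j) (1 / 8 / 2 ^ j)) (hq : ∀ j, Approx P q (z j) (1 / 8 / 2 ^ j))
    (h : MvN.mk p = MvN.mk q) : ∃ j x t k, equivTest e (y j) (z j) x t k := by
  rw [← MvN.mk_sum_zeroProj p q.1, ← MvN.mk_zeroProj_sum q p.1] at h
  obtain ⟨v, hv, hv'⟩ : ∃ v : Matrix (Fin (p.1 + q.1)) (Fin (p.1 + q.1)) A,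
      blockDiag p.2.1 (0 : Matrix (Fin q.1) (Fin q.1) A) = v * star v ∧
      blockDiag (0 : Matrix (Fin p.1) (Fin p.1) A) q.2.1 = star v * v := MvN.mk_eq_mk.1 h
  -- The certificates bound the sum of the norms of the entries, so a closer approximation than
  -- `1 / 8` is needed for them to be found.
  obtain ⟨η, hη, hη'⟩ : ∃ η : ℝ, 0 < η ∧
      (η + η) * (8 * ((p.1 + q.1 : ℕ) * (p.1 + q.1 : ℕ))) < 1 := by
    generalize ((p.1 + q.1 : ℕ) : ℝ) = N
    have hN : 0 ≤ N * N := mul_self_nonneg N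
    refine ⟨1 / (16 * (N * N) + 1), by positivity, ?_⟩
    rw [← two_mul, mul_one_div, div_mul_eq_mul_div, div_lt_one (by positivity)]
    linarith
  obtain ⟨δ, hδ, hδ'⟩ := exists_delta_mul_star (n := p.1 + q.1) v hη
  obtain ⟨x, hx⟩ := P.exists_eval_matrix_near (n := p.1 + q.1) v hδ
  obtain ⟨j, hj⟩ := exists_one_div_two_pow_lt hη
  obtain ⟨h1, h2⟩ := hδ' _ hx
  refine ⟨j, x, exists_equivTest_of_near he hη' ((hp j).mono hj.le) ((hq j).mono hj.le) ?_ ?_⟩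
  · rwa [hv]
  · rwa [hv']

end Test

/-! ### The presentation of the Murray-von Neumann semigroup -/

/-- The self-adjoint `*`-polynomial `h = x + x*` over `n × n` matrices if it is certified to be almost
idempotent, and `0` otherwise. -/
def almostProj (e : Code) (n : ℕ) (x : StarPoly) (t k : ℕ) : StarPoly :=
  bif cert e n 32 (.sub (.mul (x ++ x.conj) (x ++ x.conj)) (x ++ x.conj)) t k then x ++ x.conj
  else []

/-- The almost projection with number `i`, which codes a size `n + 1`, a `*`-polynomial and time bounds
for the certificate. -/
def generator (e : Code) (i : ℕ) : MatPoly :=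
  let d : ℕ × StarPoly × ℕ × ℕ := (Encodable.decode i).getD (0, [], 0, 0)
  (d.1 + 1, almostProj e (d.1 + 1) d.2.1 d.2.2.1 d.2.2.2)

/-- The `j`-th approximation of the projection attached to the generator `i`. -/
def generatorAt (e : Code) (j i : ℕ) : MatPoly :=
  ((generator e i).1, StarPoly.newton^[j] (generator e i).2)

/-- The `j`-th approximation of the projection attached to the word `w`. -/
def wordAt (e : Code) (w : ℕ × List ℕ) (j : ℕ) : MatPoly :=
  w.2.foldl (fun y i => y.sum (generatorAt e j i)) (generatorAt e j w.1)

section PrimrecWord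

variable {α : Type} [Primcodable α]

@[fun_prop]
theorem primrec_generator {e : α → Code} {i : α → ℕ} (he : Primrec e) (hi : Primrec i) :
    Primrec fun a => generator (e a) (i a) := by
  have h : Primrec fun a => (Encodable.decode (i a) : Option (ℕ × StarPoly × ℕ × ℕ)) :=
    Primrec.decode.comp hi
  unfold generator almostProj
  fun_prop

@[fun_prop]
theorem primrec_generatorAt {e : α → Code} {i j : α → ℕ} (he : Primrec e) (hj : Primrec j)
    (hi : Primrec i) : Primrec fun a => generatorAt (e a) (j a) (i a) := by
  have h : Primrec StarPoly.newton := StarPoly.primrec_newton primrec_id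
  unfold generatorAt
  fun_prop

@[fun_prop]
theorem primrec_wordAt {e : α → Code} {w : α → ℕ × List ℕ} {j : α → ℕ} (he : Primrec e)
    (hw : Primrec w) (hj : Primrec j) : Primrec fun a => wordAt (e a) (w a) (j a) := by
  unfold wordAt
  fun_prop

end PrimrecWord

section Presentation

/-- The iterates of `3h² - 2h³` on a `*`-polynomial approximate a single projection. -/
theorem exists_proj_of_newton {A : Type u} [CStarAlgebra A] (P : CStarPresentation A)
    {y : MatPoly} (h0 : 0 < y.1) (hsa : IsSelfAdjoint (y.2.eval (matrixPoint P.point y.1)))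
    (hd : cstarMatrixNorm (y.2.eval (matrixPoint P.point y.1) *
      y.2.eval (matrixPoint P.point y.1) - y.2.eval (matrixPoint P.point y.1)) ≤ 1 / 32) :
    ∃ p : Proj A, ∀ j, Approx P p (y.1, StarPoly.newton^[j] y.2) (1 / 8 / 2 ^ j) := by
  obtain ⟨p, hp, hp'⟩ := exists_isStarProjection_of_newton_matrix
    (h := fun j => (StarPoly.newton^[j] y.2).eval (matrixPoint P.point y.1)) hsa hd fun j => by
      rw [Function.iterate_succ_apply', StarPoly.eval_newton]
  exact ⟨⟨y.1, p, hp⟩, fun j => ⟨h0, rfl, hp' j⟩⟩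

theorem almostProj_spec {A : Type u} [CStarAlgebra A] {P : CStarPresentation A} {e : Code}
    (he : P.IsRightCEIndex e) (n : ℕ) (x : StarPoly) (t k : ℕ) :
    IsSelfAdjoint ((almostProj e n x t k).eval (matrixPoint P.point n)) ∧
    cstarMatrixNorm ((almostProj e n x t k).eval (matrixPoint P.point n) *
      (almostProj e n x t k).eval (matrixPoint P.point n) -
      (almostProj e n x t k).eval (matrixPoint P.point n)) ≤ 1 / 32 := by
  unfold almostProj
  cases h : cert e n 32 (.sub (.mul (x ++ x.conj) (x ++ x.conj)) (x ++ x.conj)) t k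
  · rw [cond_false, StarPoly.eval_nil, mul_zero, sub_zero, cstarMatrixNorm_zero]
    exact ⟨IsSelfAdjoint.zero _, by norm_num⟩
  · have h1 := cstarMatrixNorm_lt_of_cert he (by norm_num) h
    rw [StarPoly.eval_sub, StarPoly.eval_mul] at h1
    rw [cond_true]
    refine ⟨?_, by exact_mod_cast h1.le⟩
    rw [StarPoly.eval_append, StarPoly.eval_conj]
    exact IsSelfAdjoint.add_star_self _

theorem exists_generatorProj (X : CStarCE.{u}) (i : ℕ) :
    ∃ p : Proj X.carrier, ∀ j, Approx X.pres p (generatorAt X.index j i) (1 / 8 / 2 ^ j) :=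
  exists_proj_of_newton X.pres (y := generator X.index i) (Nat.succ_pos _)
    (almostProj_spec X.isIndex _ _ _ _).1 (almostProj_spec X.isIndex _ _ _ _).2

/-- The projection attached to a generator. -/
def generatorProj (X : CStarCE.{u}) (i : ℕ) : Proj X.carrier := (exists_generatorProj X i).choose

theorem approx_generatorProj (X : CStarCE.{u}) (i j : ℕ) :
    Approx X.pres (generatorProj X i) (generatorAt X.index j i) (1 / 8 / 2 ^ j) :=
  (exists_generatorProj X i).choose_spec j

/-- The projection attached to a word. -/
def wordProj (X : CStarCE.{u}) (w : ℕ × List ℕ) : Proj X.carrier :=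
  w.2.foldl (fun p i => p.sum (generatorProj X i)) (generatorProj X w.1)

theorem approx_wordProj (X : CStarCE.{u}) (w : ℕ × List ℕ) (j : ℕ) :
    Approx X.pres (wordProj X w) (wordAt X.index w j) (1 / 8 / 2 ^ j) := by
  obtain ⟨i, l⟩ := w
  unfold wordProj wordAt
  induction l using List.reverseRecOn with
  | nil => exact approx_generatorProj X i j
  | append_singleton l k ih =>
    simp only [List.foldl_append, List.foldl_cons, List.foldl_nil] at ih ⊢
    exact ih.sum (approx_generatorProj X k j)

/-- Every class is represented by a generator: a projection of positive size is approximated by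
`x + x*`, and the projection obtained from a good approximation is close to it. -/
theorem exists_generatorProj_eq (X : CStarCE.{u}) (p : Proj X.carrier) :
    ∃ i, MvN.mk (generatorProj X i) = MvN.mk p := by
  suffices H : ∀ (n : ℕ) (p : Matrix (Fin (n + 1)) (Fin (n + 1)) X.carrier)
      (hp : IsStarProjection p), ∃ i, MvN.mk (generatorProj X i) = MvN.mk ⟨n + 1, p, hp⟩ by
    obtain ⟨i, hi⟩ := H p.1 (p.sum (zeroProj X.carrier 1)).2.1 (p.sum (zeroProj X.carrier 1)).2.2
    exact ⟨i, hi.trans (MvN.mk_sum_zeroProj p 1)⟩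
  intro n p hp
  have hN : (0 : ℝ) < 32 * (((n + 1 : ℕ) : ℝ) * ((n + 1 : ℕ) : ℝ)) := by positivity
  obtain ⟨δ, hδ, hδ'⟩ := exists_delta_of_continuous
    (F := fun x : Matrix (Fin (n + 1)) (Fin (n + 1)) X.carrier =>
      (x + star x) * (x + star x) - (x + star x)) (fun B _ f => by
        simp only [map_sub, map_mul, map_add, map_star, f.apply_symm_apply]
        fun_prop) ((1 / 2 : ℂ) • p) (inv_pos.2 hN)
  obtain ⟨δ', hδ1, hδ1'⟩ := exists_delta_of_continuous
    (F := fun x : Matrix (Fin (n + 1)) (Fin (n + 1)) X.carrier => x + star x) (fun B _ f => by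
        simp only [map_add, map_star, f.apply_symm_apply]
        fun_prop) ((1 / 2 : ℂ) • p) (show (0 : ℝ) < 1 / 8 by norm_num)
  obtain ⟨x, hx⟩ := X.pres.exists_eval_matrix_near ((1 / 2 : ℂ) • p) (lt_min hδ hδ1)
  have hhalf : (1 / 2 : ℂ) • p + star ((1 / 2 : ℂ) • p) = p := by
    rw [star_smul, hp.isSelfAdjoint.star_eq, ← add_smul]
    have : (1 / 2 : ℂ) + star (1 / 2 : ℂ) = 1 := by
      norm_num [Complex.ext_iff]
    rw [this, one_smul]
  have h1 := hδ' _ (hx.trans_le (min_le_left _ _))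
  have h2 := hδ1' _ (hx.trans_le (min_le_right _ _))
  simp only [hhalf, hp.isIdempotentElem.eq, sub_self, sub_zero] at h1 h2
  have h3 : ∀ᶠ t in atTop, ∀ᶠ k in atTop, cert X.index (n + 1) 32
      (.sub (.mul (x ++ x.conj) (x ++ x.conj)) (x ++ x.conj)) t k = true := by
    refine exists_forall_cert X.isIndex ?_
    rw [StarPoly.eval_sub, StarPoly.eval_mul, StarPoly.eval_append, StarPoly.eval_conj]
    have h3 := mul_lt_mul_of_pos_right h1 hN
    rwa [inv_mul_cancel₀ hN.ne'] at h3
  obtain ⟨t, ht⟩ := h3.exists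
  obtain ⟨k, hk⟩ := ht.exists
  refine ⟨Encodable.encode (n, x, t, k), ?_⟩
  have hgen : generatorAt X.index 0 (Encodable.encode (n, x, t, k)) =
      (n + 1, x ++ x.conj) := by
    simp [generatorAt, generator, almostProj, hk]
  have h4 := approx_generatorProj X (Encodable.encode (n, x, t, k)) 0
  rw [hgen] at h4
  generalize generatorProj X (Encodable.encode (n, x, t, k)) = q at *
  obtain ⟨m, q, hq⟩ := q
  obtain ⟨-, rfl, h5⟩ := h4
  refine MvN.mk_eq_mk.2 (mvnEquiv_of_close hq hp ?_)
  rw [StarPoly.eval_append, StarPoly.eval_conj] at h5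
  refine (cstarMatrixNorm_sub_le _ _ _).trans ((add_le_add h5 h2.le).trans ?_)
  norm_num

/-- The presentation of the Murray-von Neumann semigroup whose generators are the classes of the
projections that are obtained from certified almost projections. -/
def mvnPresentation (X : CStarCE.{u}) : SemigroupPresentation (MvN X.carrier) where
  ν := FreeAddSemigroup.lift fun i => MvN.mk (generatorProj X i)
  surj := by
    rintro ⟨p⟩
    obtain ⟨i, hi⟩ := exists_generatorProj_eq X p
    exact ⟨FreeAddSemigroup.of i, hi⟩

theorem mvnPresentation_label (X : CStarCE.{u}) (w : ℕ × List ℕ) :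
    (mvnPresentation X).label w = MvN.mk (wordProj X w) := by
  obtain ⟨i, l⟩ := w
  change l.foldl (fun a i => a + MvN.mk (generatorProj X i)) (MvN.mk (generatorProj X i)) =
    MvN.mk (l.foldl (fun p i => p.sum (generatorProj X i)) (generatorProj X i))
  induction l using List.reverseRecOn with
  | nil => rfl
  | append_singleton l k ih =>
    simp only [List.foldl_append, List.foldl_cons, List.foldl_nil]
    rw [ih, MvN.mk_add_mk]

theorem exists_mvn_kernelIndex : ∃ f : Code → Code, Computable f ∧
    ∀ X : CStarCE.{u}, IsKernelIndex (mvnPresentation X).label (f X.index) := by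
  have hR : PrimrecPred fun x : (Code × (ℕ × List ℕ) × (ℕ × List ℕ)) × ℕ × StarPoly × ℕ × ℕ =>
      equivTest x.1.1 (wordAt x.1.1 x.1.2.1 x.2.1) (wordAt x.1.1 x.1.2.2 x.2.1)
        x.2.2.1 x.2.2.2.1 x.2.2.2.2 = true := by
    refine Primrec.primrecPred ?_
    simp only [Bool.decide_eq_true]
    fun_prop
  obtain ⟨f, hf, h⟩ := exists_ceSet hR
  refine ⟨f, hf, fun X => ?_⟩
  rw [IsKernelIndex, h]
  ext ⟨w, w'⟩
  simp only [Set.mem_ofPred_eq, mvnPresentation_label]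
  constructor
  · rintro ⟨⟨j, x, t, k⟩, ht⟩
    have hj : (1 : ℝ) / 8 / 2 ^ j ≤ 1 / 8 :=
      div_le_self (by norm_num) (one_le_pow₀ (by norm_num))
    exact mk_eq_mk_of_equivTest X.isIndex ((approx_wordProj X w j).mono hj)
      ((approx_wordProj X w' j).mono hj) ht
  · intro hw
    obtain ⟨j, x, t, k, ht⟩ := exists_equivTest X.isIndex (approx_wordProj X w)
      (approx_wordProj X w') hw
    exact ⟨(j, x, t, k), ht⟩

end Presentation

theorem exists_support : ∃ s : Code × (ℕ × List ℕ) → ℕ × Code, Computable s ∧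
    ∀ (X : CStarCE.{u}) (w : ℕ × List ℕ),
      ∃ p : {p : Matrix (Fin (s (X.index, w)).1) (Fin (s (X.index, w)).1) X.carrier //
          IsStarProjection p},
        IsMatrixIndex X.pres p.1 (s (X.index, w)).2 ∧
          (mvnPresentation X).label w = MvN.mk ⟨_, p⟩ := by
  have hp : Primrec fun x : (Code × (ℕ × List ℕ)) × ℕ => (wordAt x.1.1 x.1.2 x.2).2 := by
    fun_prop
  obtain ⟨g, hg, h⟩ := exists_code_total hp.to_comp
  have hn : Primrec fun x : Code × (ℕ × List ℕ) => (wordAt x.1 x.2 0).1 := by fun_prop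
  refine ⟨fun x => ((wordAt x.1 x.2 0).1, g x), hn.to_comp.pair hg, fun X w => ?_⟩
  rw [mvnPresentation_label]
  -- The size is a value of the algorithm, so it is replaced by a variable before the projection,
  -- whose type depends on it, is supplied.
  suffices H : ∀ (m : ℕ) (P : Proj X.carrier), m = P.1 → IsMatrixIndex X.pres P.2.1 (g (X.index, w)) →
      ∃ p : {p : Matrix (Fin m) (Fin m) X.carrier // IsStarProjection p},
        IsMatrixIndex X.pres p.1 (g (X.index, w)) ∧ MvN.mk P = MvN.mk ⟨m, p⟩ by
    refine H _ (wordProj X w) (approx_wordProj X w 0).2.1 fun k => ⟨_, h _ k, ?_⟩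
    refine (approx_wordProj X w k).2.2.trans_lt ?_
    rw [inv_pow, div_div, one_div]
    have : (0 : ℝ) < 2 ^ k := by positivity
    exact inv_strictAnti₀ this (by linarith)
  rintro m ⟨n, p⟩ rfl hP
  exact ⟨p, hP, rfl⟩

/-! ### Images of projections under `*`-homomorphisms -/

/-- The approximation of the entry in row `r` and column `s` of the image of `y` that the algorithm `c`
computes in `k` steps. -/
def imageEntry (c : Code) (y : MatPoly) (l k r s : ℕ) : Option StarPoly :=
  run k c (y.2.entry y.1 r s, l)

/-- Within `k` steps, the algorithm `c` approximates all entries of `y` with precision `2⁻ˡ`. -/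
def imageFound (c : Code) (y : MatPoly) (l k : ℕ) : Bool :=
  (List.range y.1).all fun r => (List.range y.1).all fun s => (imageEntry c y l k r s).isSome

/-- The matrix of the approximations that the algorithm `c` has found in `k` steps. -/
def imagePoly (c : Code) (y : MatPoly) (l k : ℕ) : MatPoly :=
  (y.1, .ofEntries y.1 fun r s => (imageEntry c y l k r s).getD [])

/-- The precision of the entries that makes the error of a matrix of size `n` at most
`1 / 16 / 2 ^ j`. -/
def imagePrec (n j : ℕ) : ℕ := n + n + j + 4

section PrimrecImage

variable {α : Type} [Primcodable α]

@[fun_prop]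
theorem primrec_imageEntry {c : α → Code} {y : α → MatPoly} {l k r s : α → ℕ} (hc : Primrec c)
    (hy : Primrec y) (hl : Primrec l) (hk : Primrec k) (hr : Primrec r) (hs : Primrec s) :
    Primrec fun a => imageEntry (c a) (y a) (l a) (k a) (r a) (s a) := by
  unfold imageEntry
  fun_prop

@[fun_prop]
theorem primrec_imageFound {c : α → Code} {y : α → MatPoly} {l k : α → ℕ} (hc : Primrec c)
    (hy : Primrec y) (hl : Primrec l) (hk : Primrec k) :
    Primrec fun a => imageFound (c a) (y a) (l a) (k a) := by
  unfold imageFound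
  fun_prop

@[fun_prop]
theorem primrec_imagePoly {c : α → Code} {y : α → MatPoly} {l k : α → ℕ} (hc : Primrec c)
    (hy : Primrec y) (hl : Primrec l) (hk : Primrec k) :
    Primrec fun a => imagePoly (c a) (y a) (l a) (k a) := by
  unfold imagePoly
  fun_prop

end PrimrecImage

section Image

variable {A B : Type u} [CStarAlgebra A] [CStarAlgebra B] {P : CStarPresentation A}
  {Q : CStarPresentation B} {ψ : A →⋆ₙₐ[ℂ] B} {c : Code}

theorem exists_imageFound (hc : IsStarHomIndex P Q ψ c) (y : MatPoly) (l : ℕ) :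
    ∃ k, imageFound c y l k := by
  have h : ∀ r s : Fin y.1, ∀ᶠ k in atTop, (imageEntry c y l k r s).isSome := by
    intro r s
    obtain ⟨q, hq, -⟩ := hc (y.2.entry y.1 r s) l
    obtain ⟨k, hk⟩ := exists_run_eq_some hq
    exact eventually_atTop.2 ⟨k, fun k' hk' => by rw [imageEntry, hk k' hk']; rfl⟩
  obtain ⟨k, hk⟩ := (eventually_all.2 fun r => eventually_all.2 fun s => h r s).exists
  refine ⟨k, ?_⟩
  simp only [imageFound, List.all_eq_true, List.mem_range]
  exact fun r hr s hs => hk ⟨r, hr⟩ ⟨s, hs⟩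

theorem Approx.image (hc : IsStarHomIndex P Q ψ c) {p : Proj A} {y : MatPoly} {j k : ℕ}
    (hp : Approx P p y (1 / 8 / 2 ^ (j + 1))) (hk : imageFound c y (imagePrec y.1 j) k) :
    Approx Q (Proj.map ψ p) (imagePoly c y (imagePrec y.1 j) k) (1 / 8 / 2 ^ j) := by
  obtain ⟨n, p, hp'⟩ := p
  obtain ⟨m, y⟩ := y
  obtain ⟨hm, rfl, h⟩ := hp
  refine ⟨hm, rfl, ?_⟩
  simp only at h hk
  change cstarMatrixNorm (p.map ψ - (imagePoly c (m, y) (imagePrec m j) k).2.eval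
    (matrixPoint Q.point m)) ≤ _
  have h1 : cstarMatrixNorm (p.map ψ - (y.eval (matrixPoint P.point m)).map ψ) ≤
      1 / 8 / 2 ^ (j + 1) := by
    rw [← Matrix.map_sub ψ (map_sub ψ)]
    exact (cstarMatrixNorm_map_le ψ _).trans h
  have h2 : cstarMatrixNorm ((y.eval (matrixPoint P.point m)).map ψ -
      (imagePoly c (m, y) (imagePrec m j) k).2.eval (matrixPoint Q.point m)) <
      1 / 8 / 2 ^ (j + 1) := by
    refine cstarMatrixNorm_lt_of_entries (by positivity) fun r s => ?_
    rw [imagePoly, StarPoly.eval_ofEntries, Matrix.sub_apply, Matrix.of_apply, Matrix.map_apply,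
      StarPoly.eval_matrixPoint_apply]
    simp only [imageFound, List.all_eq_true, List.mem_range] at hk
    obtain ⟨q, hq⟩ := Option.isSome_iff_exists.1 (hk r r.2 s s.2)
    obtain ⟨q', hq', hlt⟩ := hc (y.entry m r s) (imagePrec m j)
    obtain rfl := eq_of_run_eq_some hq' hq
    rw [hq, Option.getD_some]
    have h3 : (m : ℝ) < 2 ^ m := by exact_mod_cast Nat.lt_two_pow_self
    have h4 : (m : ℝ) * m ≤ 2 ^ m * 2 ^ m :=
      mul_le_mul h3.le h3.le (Nat.cast_nonneg _) (by positivity)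
    have hm' : (0 : ℝ) < m * m := by
      have : (0 : ℝ) < m := by exact_mod_cast hm
      positivity
    calc _ < (2 : ℝ)⁻¹ ^ (imagePrec m j) * (m * m) := mul_lt_mul_of_pos_right hlt hm'
      _ ≤ (2 : ℝ)⁻¹ ^ (imagePrec m j) * (2 ^ m * 2 ^ m) :=
        mul_le_mul_of_nonneg_left h4 (by positivity)
      _ = 1 / 8 / 2 ^ (j + 1) := by
        rw [imagePrec, inv_pow, pow_add, pow_add, pow_add, pow_succ]
        field_simp
        ring
  refine (cstarMatrixNorm_sub_le _ _ _).trans ((add_le_add h1 h2.le).trans (le_of_eq ?_))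
  rw [pow_succ]
  field_simp
  norm_num

end Image

theorem exists_mvn_mapIndex : ∃ g : Code × Code × Code → Code, Computable g ∧
    ∀ (X Y : CStarCE.{u}) (ψ : X ⟶ Y) (c : Code),
      IsStarHomIndex X.pres Y.pres (CStarCE.hom ψ) c →
      IsMapIndex (mvnPresentation X).label (mvnPresentation Y).label
        (MvN.map (CStarCE.hom ψ)) (g (X.index, Y.index, c)) := by
  have hF : Primrec fun x : ((Code × Code × Code) × (ℕ × List ℕ)) ×
      ((ℕ × List ℕ) × ℕ × ℕ × StarPoly × ℕ × ℕ) =>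
      let y := wordAt x.1.1.1 x.1.2 (x.2.2.1 + 1)
      let l := imagePrec y.1 x.2.2.1
      bif imageFound x.1.1.2.2 y l x.2.2.2.1 &&
        equivTest x.1.1.2.1 (imagePoly x.1.1.2.2 y l x.2.2.2.1)
          (wordAt x.1.1.2.1 x.2.1 x.2.2.1) x.2.2.2.2.1 x.2.2.2.2.2.1 x.2.2.2.2.2.2
      then some x.2.1 else none := by
    unfold imagePrec
    fun_prop
  obtain ⟨g, hg, h⟩ := exists_search hF.to_comp
  refine ⟨g, hg, fun X Y ψ c hc w => ?_⟩
  obtain ⟨-, h⟩ := h (X.index, Y.index, c) w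
  simp only [Bool.cond_eq_ite, Option.ite_none_right_eq_some, Bool.and_eq_true,
    Option.some.injEq] at h
  obtain ⟨⟨v, j, k, x, t, k'⟩, v', ⟨⟨hk, ht⟩, hv⟩, hout⟩ := h (by
    obtain ⟨v, hv⟩ := (mvnPresentation Y).surj (MvN.map (CStarCE.hom ψ)
      (MvN.mk (wordProj X w)))
    replace hv : (mvnPresentation Y).label (v.1, v.2) = _ := hv
    rw [mvnPresentation_label] at hv
    choose k hk using fun j => exists_imageFound hc (wordAt X.index w (j + 1))
      (imagePrec (wordAt X.index w (j + 1)).1 j)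
    obtain ⟨j, x, t, k', ht⟩ := exists_equivTest Y.isIndex
      (fun j => (approx_wordProj X w (j + 1)).image hc (hk j))
      (approx_wordProj Y (v.1, v.2)) hv.symm
    exact ⟨((v.1, v.2), j, k j, x, t, k'), (v.1, v.2), ⟨hk j, ht⟩, rfl⟩)
  subst hv
  refine ⟨v, hout, ?_⟩
  have hj : (1 : ℝ) / 8 / 2 ^ j ≤ 1 / 8 :=
    div_le_self (by norm_num) (one_le_pow₀ (by norm_num))
  rw [mvnPresentation_label, mvnPresentation_label]
  exact (mk_eq_mk_of_equivTest Y.isIndex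
    (((approx_wordProj X w (j + 1)).image hc hk).mono hj)
    ((approx_wordProj Y v j).mono hj) ht).symm

/-- The functor `D` on c.e. presentations. -/
def mvnPresentations : MvNPresentations.{u} where
  pres := mvnPresentation
  ce X := ⟨_, exists_mvn_kernelIndex.choose_spec.2 X⟩
  map_computable {X Y} ψ :=
    Exists.elim ψ.2 fun c hc => ⟨_, exists_mvn_mapIndex.choose_spec.2 X Y ψ c hc⟩

theorem isComputableFunctor_mvn : IsComputableFunctor mvnPresentations.{u}.functor := by
  obtain ⟨f, hf, hf'⟩ := exists_mvn_kernelIndex.{u}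
  obtain ⟨g, hg, hg'⟩ := exists_mvn_mapIndex.{u}
  refine ⟨⟨f, hf, ?_⟩, g, hg, ?_⟩
  · rintro X e rfl
    exact hf' X
  · rintro X Y ψ e e' c rfl rfl hc
    exact hg' X Y ψ c hc

/-! ### The Grothendieck group of a presented semigroup -/

/-- The word of the semigroup that consists of `0` and the letters with sign `b` of a word of the free
group. The additional letter makes the word nonempty; it cancels in the formal difference of the
positive and the negative part. -/
def signPart (b : Bool) (w : List (ℕ × Bool)) : ℕ × List ℕ :=
  (0, w.flatMap fun l => bif decide (l.2 = b) then [l.1] else [])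

/-- The letters of a word of the semigroup, all with the sign `b`. -/
def signWord (b : Bool) (w : ℕ × List ℕ) : List (ℕ × Bool) :=
  (w.1 :: w.2).map fun i => (i, b)

/-- The concatenation of two words of the free semigroup. -/
def wordAdd (w v : ℕ × List ℕ) : ℕ × List ℕ := (w.1, w.2 ++ v.1 :: v.2)

section PrimrecSign

variable {α : Type} [Primcodable α]

@[fun_prop]
theorem primrec_signPart {b : α → Bool} {w : α → List (ℕ × Bool)} (hb : Primrec b)
    (hw : Primrec w) : Primrec fun a => signPart (b a) (w a) := by
  unfold signPart
  fun_prop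

@[fun_prop]
theorem primrec_signWord {b : α → Bool} {w : α → ℕ × List ℕ} (hb : Primrec b)
    (hw : Primrec w) : Primrec fun a => signWord (b a) (w a) := by
  unfold signWord
  fun_prop

@[fun_prop]
theorem primrec_wordAdd {w v : α → ℕ × List ℕ} (hw : Primrec w) (hv : Primrec v) :
    Primrec fun a => wordAdd (w a) (v a) := by
  unfold wordAdd
  fun_prop

end PrimrecSign

section Groth

variable {S : Type u} [AddCommSemigroup S] (P : SemigroupPresentation S)

theorem SemigroupPresentation.label_wordAdd (w v : ℕ × List ℕ) :
    P.label (wordAdd w v) = P.label w + P.label v :=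
  map_add P.ν ⟨w.1, w.2⟩ ⟨v.1, v.2⟩

theorem SemigroupPresentation.exists_label_eq (x : S) : ∃ w, P.label w = x := by
  obtain ⟨w, hw⟩ := P.surj x
  exact ⟨(w.1, w.2), hw⟩

variable [Nonempty S]

theorem Groth.of_add (a b : S) : Groth.of (a + b) = Groth.of a + Groth.of b := by
  rw [Groth.of_eq a a, Groth.of_eq b b, Groth.mk_add_mk, Groth.of_eq _ (a + b)]
  congr 1
  ac_rfl

theorem Groth.mk_eq_sub (a b : S) : Groth.mk a b = Groth.of a - Groth.of b := by
  rw [eq_sub_iff_add_eq, Groth.of_eq a a, Groth.of_eq b b, Groth.mk_add_mk]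
  exact Groth.mk_eq_mk.2 ⟨a, by ac_rfl⟩

/-- The homomorphism of the free group that sends the `i`-th generator to the class of the `i`-th
generator of the semigroup. -/
def grothNu : FreeAddGroup ℕ →+ Groth S := FreeAddGroup.lift fun i => Groth.of (P.label (i, []))

theorem grothNu_mk_cons (l : ℕ × Bool) (w : List (ℕ × Bool)) :
    grothNu P (FreeAddGroup.mk (l :: w)) =
      (bif l.2 then Groth.of (P.label (l.1, [])) else -Groth.of (P.label (l.1, []))) +
        grothNu P (FreeAddGroup.mk w) := by
  simp [grothNu, FreeAddGroup.lift_mk]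

theorem grothNu_mk_append (w v : List (ℕ × Bool)) :
    grothNu P (FreeAddGroup.mk (w ++ v)) =
      grothNu P (FreeAddGroup.mk w) + grothNu P (FreeAddGroup.mk v) := by
  rw [← FreeAddGroup.add_mk, map_add]

theorem grothNu_signWord (b : Bool) (w : ℕ × List ℕ) :
    grothNu P (FreeAddGroup.mk (signWord b w)) =
      bif b then Groth.of (P.label w) else -Groth.of (P.label w) := by
  obtain ⟨i, l⟩ := w
  have hnil : grothNu P (FreeAddGroup.mk []) = 0 := map_zero _
  induction l generalizing i with
  | nil => rw [signWord, List.map_cons, grothNu_mk_cons, List.map_nil, hnil, add_zero]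
  | cons j l ih =>
    have h1 : P.label (i, j :: l) = P.label (i, []) + P.label (j, l) :=
      P.label_wordAdd (i, []) (j, l)
    have h2 := ih j
    rw [signWord] at h2 ⊢
    rw [List.map_cons, grothNu_mk_cons]
    simp only at h2 ⊢
    rw [h2, h1, Groth.of_add]
    cases b <;> simp [add_comm]

/-- The element labelled by a word of the free group is the formal difference of its positive and its
negative part. -/
theorem grothNu_mk (w : List (ℕ × Bool)) : grothNu P (FreeAddGroup.mk w) =
    Groth.mk (P.label (signPart true w)) (P.label (signPart false w)) := by
  rw [Groth.mk_eq_sub]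
  induction w with
  | nil => rw [show signPart true [] = signPart false [] from rfl, sub_self]; exact map_zero _
  | cons l w ih =>
    have hcons : ∀ (i : ℕ) (v : List ℕ), Groth.of (P.label (0, i :: v)) =
        Groth.of (P.label (i, [])) + Groth.of (P.label (0, v)) := by
      intro i v
      have h1 : P.label (0, i :: v) = P.label (0, []) + P.label (i, v) :=
        P.label_wordAdd (0, []) (i, v)
      cases v with
      | nil => rw [h1, Groth.of_add, add_comm]
      | cons j v =>
        have h2 : P.label (i, j :: v) = P.label (i, []) + P.label (j, v) :=
          P.label_wordAdd (i, []) (j, v)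
        have h3 : P.label (0, j :: v) = P.label (0, []) + P.label (j, v) :=
          P.label_wordAdd (0, []) (j, v)
        rw [h1, h2, h3]
        simp only [Groth.of_add]
        abel
    obtain ⟨i, b⟩ := l
    rw [grothNu_mk_cons, ih]
    cases b <;> simp [signPart, hcons] <;> abel

theorem grothNu_surjective : Function.Surjective (grothNu P) := by
  refine Groth.ind fun a b => ?_
  obtain ⟨w, rfl⟩ := P.exists_label_eq a
  obtain ⟨v, rfl⟩ := P.exists_label_eq b
  refine ⟨FreeAddGroup.mk (signWord true w ++ signWord false v), ?_⟩
  rw [grothNu_mk_append, grothNu_signWord, grothNu_signWord, Groth.mk_eq_sub, sub_eq_add_neg]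
  rfl

/-- The presentation of the Grothendieck group whose generators are the classes of the generators of
the semigroup. -/
def grothPresentation : GroupPresentation (Groth S) := ⟨grothNu P, grothNu_surjective P⟩

theorem grothPresentation_label (w : List (ℕ × Bool)) : (grothPresentation P).label w =
    Groth.mk (P.label (signPart true w)) (P.label (signPart false w)) := grothNu_mk P w

theorem grothPresentation_label_signWord (w v : ℕ × List ℕ) :
    (grothPresentation P).label (signWord true w ++ signWord false v) =
      Groth.mk (P.label w) (P.label v) := by
  rw [Groth.mk_eq_sub, sub_eq_add_neg]
  change grothNu P (FreeAddGroup.mk _) = _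
  rw [grothNu_mk_append, grothNu_signWord, grothNu_signWord]
  rfl

end Groth

theorem exists_groth_kernelIndex : ∃ f : Code → Code, Computable f ∧
    ∀ (S : Type u) [AddCommSemigroup S] [Nonempty S] (P : SemigroupPresentation S) (e : Code),
      IsKernelIndex P.label e → IsKernelIndex (grothPresentation P).label (f e) := by
  have hR : PrimrecPred fun x : (Code × List (ℕ × Bool) × List (ℕ × Bool)) × (ℕ × List ℕ) × ℕ =>
      (x.1.1.evaln x.2.2 (Encodable.encode
        (wordAdd (wordAdd (signPart true x.1.2.1) (signPart false x.1.2.2)) x.2.1,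
          wordAdd (wordAdd (signPart true x.1.2.2) (signPart false x.1.2.1)) x.2.1))).isSome =
        true := by
    refine Primrec.primrecPred ?_
    simp only [Bool.decide_eq_true]
    refine Primrec.option_isSome.comp (Code.primrec_evaln.comp
      (Primrec.pair (Primrec.pair (by fun_prop) (by fun_prop)) (Primrec.encode.comp ?_)))
    fun_prop
  obtain ⟨f, hf, h⟩ := exists_ceSet hR
  refine ⟨f, hf, fun S _ _ P e he => ?_⟩
  rw [IsKernelIndex, h]
  ext ⟨w, v⟩
  simp only [Set.mem_ofPred_eq, grothPresentation_label, Groth.mk_eq_mk]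
  have key : ∀ x y, P.label x = P.label y ↔
      ∃ k, (e.evaln k (Encodable.encode (x, y))).isSome := by
    intro x y
    rw [← mem_ceSet_iff, he]
    rfl
  simp only [Prod.exists]
  constructor
  · rintro ⟨z1, z2, k, hk⟩
    have h2 := (key _ _).2 ⟨k, hk⟩
    simp only [P.label_wordAdd] at h2
    exact ⟨_, h2⟩
  · rintro ⟨z, hz⟩
    obtain ⟨z, rfl⟩ := P.exists_label_eq z
    simp only [← P.label_wordAdd] at hz
    obtain ⟨k, hk⟩ := (key _ _).1 hz
    exact ⟨z.1, z.2, k, hk⟩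

theorem exists_groth_mapIndex : ∃ g : Code → Code, Computable g ∧
    ∀ (S T : Type u) [AddCommSemigroup S] [Nonempty S] [AddCommSemigroup T] [Nonempty T]
      (P : SemigroupPresentation S) (Q : SemigroupPresentation T) (φ : S →ₙ+ T) (c : Code),
      IsMapIndex P.label Q.label φ c →
      IsMapIndex (grothPresentation P).label (grothPresentation Q).label (Groth.map φ) (g c) := by
  have hF : Primrec fun x : (Code × List (ℕ × Bool)) × ℕ =>
      (run x.2 x.1.1 (signPart true x.1.2) : Option (ℕ × List ℕ)).bind fun v =>
        (run x.2 x.1.1 (signPart false x.1.2) : Option (ℕ × List ℕ)).map fun v' =>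
          signWord true v ++ signWord false v' := by
    fun_prop
  obtain ⟨g, hg, h⟩ := exists_search hF.to_comp
  refine ⟨g, hg, fun S T _ _ _ _ P Q φ c hc w => ?_⟩
  obtain ⟨-, h⟩ := h c w
  obtain ⟨v, hv, hv'⟩ := hc (signPart true w)
  obtain ⟨v', hw, hw'⟩ := hc (signPart false w)
  obtain ⟨k, hk⟩ := exists_run_eq_some hv
  obtain ⟨k', hk'⟩ := exists_run_eq_some hw
  obtain ⟨t, b, hb, hout⟩ := h ⟨max k k', signWord true v ++ signWord false v', by
    simp only [hk _ (le_max_left k k'), hk' _ (le_max_right k k'), Option.bind_some,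
      Option.map_some]⟩
  refine ⟨b, hout, ?_⟩
  obtain ⟨u, hu, hb⟩ := Option.bind_eq_some_iff.1 hb
  obtain ⟨u', hu', rfl⟩ := Option.map_eq_some_iff.1 hb
  obtain rfl := eq_of_run_eq_some hv hu
  obtain rfl := eq_of_run_eq_some hw hu'
  rw [grothPresentation_label_signWord, grothPresentation_label, Groth.map_mk, hv', hw']

/-- The functor `G` on c.e. presentations. -/
def grothPresentations : GrothPresentations.{u} where
  pres Y := grothPresentation Y.pres
  ce Y := Exists.elim Y.ce fun e he =>
    ⟨_, exists_groth_kernelIndex.choose_spec.2 Y.carrier Y.pres e he⟩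
  map_computable {X Y} φ := Exists.elim φ.2 fun c hc =>
    ⟨_, exists_groth_mapIndex.choose_spec.2 X.carrier Y.carrier X.pres Y.pres φ.1 c hc⟩

theorem isComputableFunctor_groth : IsComputableFunctor grothPresentations.{u}.functor := by
  obtain ⟨f, hf, hf'⟩ := exists_groth_kernelIndex.{u}
  obtain ⟨g, hg, hg'⟩ := exists_groth_mapIndex.{u}
  refine ⟨⟨f, hf, fun Y e he => hf' Y.carrier Y.pres e he⟩, fun x => g x.2.2,
    hg.comp (Computable.snd.comp Computable.snd), fun X Y φ _ _ c _ _ hc => ?_⟩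
  exact hg' X.carrier Y.carrier X.pres Y.pres φ.1 c hc

theorem computableOf_groth : grothPresentations.{u}.ComputableOf := by
  have h : Primrec fun x : Code × (ℕ × List ℕ) => signWord true x.2 := by fun_prop
  obtain ⟨g, hg, hg'⟩ := exists_code_total h.to_comp
  exact ⟨g, hg, fun Y e _ w => ⟨_, hg' e w, grothNu_signWord Y.pres true w⟩⟩

/-! ### The group `K_0` -/

/-- The composition of computable functors is computable. -/
theorem IsComputableFunctor.comp {C D E : Type (u + 1)} [IndexedCategory C] [IndexedCategory D]
    [IndexedCategory E] {F : C ⥤ D} {G : D ⥤ E} (hF : IsComputableFunctor F)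
    (hG : IsComputableFunctor G) : IsComputableFunctor (F ⋙ G) := by
  obtain ⟨⟨f, hf, hf'⟩, g, hg, hg'⟩ := hF
  obtain ⟨⟨f₁, hf₁, hf₁'⟩, g₁, hg₁, hg₁'⟩ := hG
  refine ⟨⟨f₁ ∘ f, hf₁.comp hf, fun X e he => hf₁' _ _ (hf' X e he)⟩,
    fun x => g₁ (f x.1, f x.2.1, g x), ?_, fun X Y φ e e' c he he' hc => ?_⟩
  · exact hg₁.comp ((hf.comp Computable.fst).pair
      ((hf.comp (Computable.fst.comp Computable.snd)).pair hg))
  · exact hg₁' _ _ _ _ _ _ (hf' X e he) (hf' Y e' he') (hg' X Y φ e e' c he he' hc)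

/-- A label of an element of the positive cone is recognized by a search for a word of the semigroup
with the same class; this needs no hypothesis on the algebra. -/
theorem isCESubset_positiveCone (X : CStarCE.{u}) :
    IsCESubset (k0Presentation mvnPresentations grothPresentations X).label
      (K0.positiveCone X.carrier) := by
  obtain ⟨c, hc⟩ := grothPresentations.ce (mvnPresentations.functor.obj X)
  have hR : PrimrecPred fun x : (Code × List (ℕ × Bool)) × (ℕ × List ℕ) × ℕ =>
      (x.1.1.evaln x.2.2 (Encodable.encode (x.1.2, signWord true x.2.1))).isSome = true := by
    refine Primrec.primrecPred ?_
    simp only [Bool.decide_eq_true]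
    refine Primrec.option_isSome.comp (Code.primrec_evaln.comp
      (Primrec.pair (Primrec.pair (by fun_prop) (by fun_prop)) (Primrec.encode.comp ?_)))
    fun_prop
  obtain ⟨g, -, hg⟩ := exists_ceSet hR
  refine (rePred_mem_ceSet (g c)).of_eq fun w => ?_
  have key : ∀ v, (∃ k, (c.evaln k (Encodable.encode (w, signWord true v))).isSome) ↔
      (k0Presentation mvnPresentations grothPresentations X).label w =
        Groth.of ((mvnPresentation X).label v) := by
    intro v
    rw [← mem_ceSet_iff, hc, ← show _ = Groth.of ((mvnPresentation X).label v) from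
      grothNu_signWord (mvnPresentation X) true v]
    rfl
  rw [hg]
  simp only [Set.mem_ofPred_eq, Prod.exists, K0.positiveCone]
  constructor
  · rintro ⟨i, l, hk⟩
    exact ⟨wordProj X (i, l), by rw [← mvnPresentation_label]; exact (key (i, l)).1 hk⟩
  · rintro ⟨p, hp⟩
    obtain ⟨v, hv⟩ := (mvnPresentation X).exists_label_eq (MvN.mk p)
    exact ⟨v.1, v.2, (key v).2 (by rw [hv, hp])⟩

end

end EffectiveK

theorem mainTheorem1 :
    ∃ (D : MvNPresentations.{u}) (G : GrothPresentations.{u}),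
      IsComputableFunctor D.functor ∧ D.Supported ∧
      IsComputableFunctor G.functor ∧ G.ComputableOf ∧
      IsComputableFunctor (k0Functor D G) ∧
      ∀ X : CStarCE.{u}, StablyFinite X.carrier →
        IsCESubset (k0Presentation D G X).label (K0.positiveCone X.carrier) :=
  ⟨mvnPresentations, grothPresentations, isComputableFunctor_mvn, exists_support,
    isComputableFunctor_groth, computableOf_groth,
    isComputableFunctor_mvn.comp isComputableFunctor_groth,
    fun X _ => isCESubset_positiveCone X⟩
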